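/- **Flat octahedra of type 3.** Let $K_B\neq K_C$ be two circles in the plane with a common center. Let $A_1B_1A_2B_2$ be a convex quadrilateral whose sides are tangent to $K_C$ (each side touches $K_C$ at a point of the side; three consecutive vertices may lie on a line). Let $A_1C_1A_2C_2$ be a quadrilateral with a self-intersection (two opposite sides cross at an interior point of each, and the vertices are not all on one line) such that every straight line containing one of its sides is tangent to $K_B$. Place the plane in $\mathbb R^3$. The points $A_1,A_2,B_1,B_2,C_1,C_2$ are the vertices of an octahedron in a flat position; its faces are the eight triangles $A_iB_jC_k$ with $i,j,k\in\{1,2\}$, and its edges are the sides of the quadrilaterals $A_1B_1A_2B_2$, $A_1C_1A_2C_2$, $B_1C_1B_2C_2$, which are called its equators. **Flexes.** A flex is a continuous motion of the six vertices in $\mathbb R^3$, parametrized by an interval, during which the lengths of all twelve edges stay constant (so every face stays congruent to itself). A *Bricard octahedron of type 3* is an octahedron obtained by a flex from a flat position as above. **Dihedral angles.** Fix an orientation of the octahedron, given by unit normals to its faces. A dihedral angle at an edge $\ell$ with adjacent faces $Q_1,Q_2$ is a real number $\alpha$ such that the rotation by the angle $\alpha$ about $\ell$, in the direction of the normal of $Q_1$,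 takes the half-plane bounded by $\ell$ and containing $Q_1$ to the one containing $Q_2$; it is determined up to a multiple of $2\pi$. **Theorem 6.** Let $\mathscr O(t)$, $t\in I$ ($I\subset\mathbb R$ an interval), be a flex of an oriented Bricard octahedron of type 3, let $E$ be any of its three equators, and for every edge $\ell$ of $E$ let $\alpha_\ell(t)$ be a dihedral angle of $\mathscr O(t)$ at $\ell$, chosen to be continuous in $t$. Then for every $\mathbb Q$-linear function $f:\mathbb R\to\mathbb R$ with $f(\pi)=0$, $$\sum_{\ell\in E}|\ell|\,f\bigl(\alpha_\ell(t)\bigr)=0\qquad\text{for all } t\in I,$$ where $|\ell|$ is the length of $\ell$. -/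

import Mathlib

open scoped RealInnerProductSpace Matrix Affine

noncomputable section

namespace Bricard

/-- The Euclidean plane. -/
abbrev Plane := EuclideanSpace ℝ (Fin 2)

/-- Euclidean 3-space. -/
abbrev Space := EuclideanSpace ℝ (Fin 3)

/-- A placement of the six labelled vertices of an octahedron in `E`: the vertices
`A₁, A₂, B₁, B₂, C₁, C₂` are `Q 0 0, Q 0 1, Q 1 0, Q 1 1, Q 2 0, Q 2 1`.

The two vertices of one class are opposite to each other. With the classes numbered cyclically
modulo 3, the edges are the segments from `Q r i` to `Q (r + 1) j`, the faces are the triangles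
`Q r i`, `Q (r + 1) j`, `Q (r + 2) k`, and the three equators `A₁B₁A₂B₂`, `B₁C₁B₂C₂`, `C₁A₁C₂A₂`
correspond to `r = 0, 1, 2`: the `r`-th one consists of the four edges from `Q r i`
to `Q (r + 1) j`. -/
abbrev Placement (E : Type*) := Fin 3 → Fin 2 → E

/-- Consecutive vertices of the closed quadrilateral `XYZW` are distinct and the vertices do not
all lie on one line. -/
def IsQuadrilateral (X Y Z W : Plane) : Prop :=
  X ≠ Y ∧ Y ≠ Z ∧ Z ≠ W ∧ W ≠ X ∧ ¬ Collinear ℝ {X, Y, Z, W}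

/-- The quadrilateral `XYZW` is convex (its diagonals meet); an angle equal to `π` is allowed. -/
def IsConvexQuadrilateral (X Y Z W : Plane) : Prop :=
  IsQuadrilateral X Y Z W ∧ (segment ℝ X Z ∩ segment ℝ Y W).Nonempty

/-- The quadrilateral `XYZW` has a self-intersection: two opposite sides cross each other. -/
def IsSelfIntersectingQuadrilateral (X Y Z W : Plane) : Prop :=
  IsQuadrilateral X Y Z W ∧
    ((openSegment ℝ X Y ∩ openSegment ℝ Z W).Nonempty ∨
      (openSegment ℝ Y Z ∩ openSegment ℝ W X).Nonempty)

/-- The segment `XY` touches the circle `K`: the line `XY` is tangent to `K`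
at a point of the segment. -/
def SegmentTangent (K : EuclideanGeometry.Sphere Plane) (X Y : Plane) : Prop :=
  ∃ c ∈ segment ℝ X Y, K.IsTangentAt c line[ℝ, X, Y]

/-- Flat positions, in the plane, of Bricard octahedra of type 3. There are two different
concentric circles `K_C`, `K_B`; the quadrilateral `A₁B₁A₂B₂` is convex with its sides tangent
to `K_C`; the quadrilateral `A₁C₁A₂C₂` is self-intersecting and the straight lines containing
its sides are tangent to `K_B`. -/
def IsFlatType3 (p : Placement Plane) : Prop :=
  ∃ K_B K_C : EuclideanGeometry.Sphere Plane,
    K_B ≠ K_C ∧ K_B.center = K_C.center ∧ 0 < K_B.radius ∧ 0 < K_C.radius ∧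
    IsConvexQuadrilateral (p 0 0) (p 1 0) (p 0 1) (p 1 1) ∧
    (∀ i j, SegmentTangent K_C (p 0 i) (p 1 j)) ∧
    IsSelfIntersectingQuadrilateral (p 0 0) (p 2 0) (p 0 1) (p 2 1) ∧
    (∀ i k, K_B.IsTangent line[ℝ, p 0 i, p 2 k])

/-- `P` is a continuous flex over the interval `I`: the vertices move continuously and all edge
lengths are constant, so that every face remains congruent to itself. -/
def IsFlexOn (P : ℝ → Placement Space) (I : Set ℝ) : Prop :=
  I.OrdConnected ∧ ContinuousOn P I ∧
    ∀ s ∈ I, ∀ t ∈ I, ∀ (r : Fin 3) (i j : Fin 2),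
      dist (P s r i) (P s (r + 1) j) = dist (P t r i) (P t (r + 1) j)

/-- `Q` is a Bricard octahedron of type 3 in space: it is obtained by a continuous flex from
a flat position, which lies in an arbitrary plane of the space. -/
def IsBricardType3 (Q : Placement Space) : Prop :=
  ∃ p : Placement Plane, IsFlatType3 p ∧
    ∃ (φ : Plane →ᵃⁱ[ℝ] Space) (P : ℝ → Placement Space),
      IsFlexOn P (Set.Icc 0 1) ∧ (P 0 = fun r i => φ (p r i)) ∧ P 1 = Q

/-- The cross product in Euclidean 3-space. -/
def cross (u v : Space) : Space :=
  WithLp.toLp 2 ((WithLp.ofLp u) ⨯₃ (WithLp.ofLp v))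

/-- The unit vector perpendicular to the line `xy` and pointing from this line towards `z`. It
spans, together with the line, the half-plane that is bounded by the line and contains `z`. -/
def towards (x y z : Space) : Space :=
  NormedSpace.normalize ((z - x) - (⟪y - x, z - x⟫ / ‖y - x‖ ^ 2) • (y - x))

/-- The unit normals to the faces that set an orientation of the octahedron. The two values of `ε`
give the two orientations; two faces with a common edge differ in exactly one of `i, j, k`. -/
def faceNormal (ε : ℤˣ) (Q : Placement Space) (r : Fin 3) (i j k : Fin 2) : Space :=
  (ε * (-1) ^ ((i : ℕ) + (j : ℕ) + (k : ℕ))) •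
    NormedSpace.normalize (cross (Q (r + 1) j - Q r i) (Q (r + 2) k - Q r i))

/-- `α` is one of the values of the (multi-valued) dihedral angle at the edge from `Q r i` to
`Q (r + 1) j`: the rotation by `α` around the edge, in the direction of the normal of the first
of the two adjacent faces, takes the half-plane of the first face to that of the second one. -/
def IsDihedralAngle (ε : ℤˣ) (Q : Placement Space) (r : Fin 3) (i j : Fin 2) (α : ℝ) : Prop :=
  towards (Q r i) (Q (r + 1) j) (Q (r + 2) 1) =
    Real.cos α • towards (Q r i) (Q (r + 1) j) (Q (r + 2) 0) +
      Real.sin α • faceNormal ε Q r i j 0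

end Bricard

end

/-!
The flex enters only through the constancy of the edge lengths, so the identity is proved for every
octahedron `Q` in space whose edges have the lengths of a flat octahedron `X` of type 3.

*The flat position.* With the common centre of the circles at the origin of `ℂ`, an edge lies on a
line `{(κ + s i) n}`, `n` a unit vector, where `κ` is the radius of the circle of its equator and
`s` the oriented distance ("offset") from the point of contact. A refinement of Newton's theorem
(`newton_pencil`) says that, in line coordinates, the pair of points `B₁, B₂` lies in the pencil of
conics spanned by the pair `A₁, A₂` and the circle `K_C`, and similarly for `C₁, C₂` and `K_B`.
Eliminating the pair `A₁, A₂` gives a third concentric circle that touches the lines of the third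
equator (`third_circle`). So all three equators are of the same kind, and the two tangents from a
vertex have opposite offsets. Convexity and self-intersection are used to decide which degenerate or
symmetric configurations occur; what is needed is collected in `TangentFrame`.

*A vertex.* The link of a vertex is a spherical quadrilateral with opposite sides equal or
supplementary. After orienting the edges like the tangents, it has an axis or a plane of symmetry.
Measure the dihedral angle at an edge between the half-planes that contain, in the flat position,
the centre of the circles. Then opposite dihedral angles of the link have the same cosine, and there
are two families (`vertex_dichotomy`): either opposite sines are negatives of each other and the
half-angle tangents at adjacent edges are in the inverse ratio of the radii of the circles, or
opposite sines are equal and the ratio also depends on the distance of the vertex from the centre.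
Unless the octahedron is folded flat along both equators through a class of vertices, the second
family therefore occurs at both vertices of the class or at none, and only if they are equidistant
from the centre (`class_dichotomy`). This never happens for the vertices `B₁, B₂`.

*An equator.* The four dihedral angles at an equator have the same cosine by the above, hence they
agree up to sign and multiples of `π` once measured from the flat position, and `f` takes the values
`± f α` at them. The signs are those of the sines, and the claim becomes the vanishing of a signed
sum of the edge lengths. Each length is a difference of offsets, and these cancel by the signs at
the two classes of vertices of the equator (`TangentFrame.sum_frameSin`). If the common angle is a
multiple of `π`, all values of `f` vanish.
-/

noncomputable section

namespace Bricard

/-! ### Spherical quadrilaterals with equal opposite sides -/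

/-- Two orthogonal subspaces of three-space cannot both be two-dimensional. -/
lemma cross_eq_zero_or_cross_eq_zero {u v w z : Fin 3 → ℝ}
    (huv : u ⬝ᵥ v = 0) (hvw : v ⬝ᵥ w = 0) (huz : u ⬝ᵥ z = 0) (hwz : w ⬝ᵥ z = 0) :
    u ⨯₃ w = 0 ∨ v ⨯₃ z = 0 := by
  by_cases hN : u ⨯₃ w = 0
  · exact Or.inl hN
  right
  set N := u ⨯₃ w with hNdef
  have h1 : v ⨯₃ N = 0 := by
    rw [hNdef, cross_cross_eq_smul_sub_smul', hvw, huv]; simp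
  have h2 : z ⨯₃ N = 0 := by
    rw [hNdef, cross_cross_eq_smul_sub_smul', dotProduct_comm z w, hwz, huz]; simp
  have h3 : N ⨯₃ (v ⨯₃ z) = 0 := by
    rw [leibniz_cross, ← cross_anticomm v N, ← cross_anticomm z N, h1, h2]; simp
  have h4 : N ⬝ᵥ (v ⨯₃ z) = 0 := by
    rw [triple_product_permutation, h2]; simp
  have h5 := cross_dot_cross N (v ⨯₃ z) N (v ⨯₃ z)
  rw [h3, h4] at h5
  have h6 : (N ⬝ᵥ N) * ((v ⨯₃ z) ⬝ᵥ (v ⨯₃ z)) = 0 := by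
    simpa using h5.symm
  rcases mul_eq_zero.1 h6 with h | h
  · exact absurd (dotProduct_self_eq_zero.1 h) hN
  · exact dotProduct_self_eq_zero.1 h

lemma sq_dotProduct_of_cross_eq_zero {u w : Fin 3 → ℝ} (h : u ⨯₃ w = 0) :
    (u ⬝ᵥ u) * (w ⬝ᵥ w) = (u ⬝ᵥ w) ^ 2 := by
  have := cross_dot_cross u w u w
  rw [h, dotProduct_comm w u] at this
  simp only [dotProduct_zero] at this
  linarith

/-- The two families of shapes of a spherical quadrilateral `b₀c₀b₁c₁` whose sides come in equal
opposite pairs, written for the half-angle tangents: `(1 - C) (1 + C') / ((1 + C) (1 - C'))` is the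
ratio of the squares of the tangents of the half dihedral angles with cosines `C` at `b₀`, `b₁` and
`C'` at `c₀`, `c₁`. The quadrilateral has an axis or a plane of symmetry, because the vectors
`b₀ + b₁`, `c₀ + c₁` are orthogonal to `b₀ - b₁`, `c₀ - c₁`, so one of these pairs is parallel. -/
lemma isogram_dichotomy {b₀ b₁ c₀ c₁ : Fin 3 → ℝ} {κ κ' s s' R C C' : ℝ} (hR : R ≠ 0)
    (hs : κ ^ 2 + s ^ 2 = R) (hs' : κ' ^ 2 + s' ^ 2 = R) (hκ : κ ^ 2 ≠ κ' ^ 2)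
    (hb₀ : b₀ ⬝ᵥ b₀ = 1) (hb₁ : b₁ ⬝ᵥ b₁ = 1) (hc₀ : c₀ ⬝ᵥ c₀ = 1) (hc₁ : c₁ ⬝ᵥ c₁ = 1)
    (h₀₀ : b₀ ⬝ᵥ c₀ = (κ * κ' + s * s') / R) (h₀₁ : b₀ ⬝ᵥ c₁ = (κ * κ' - s * s') / R)
    (h₁₀ : b₁ ⬝ᵥ c₀ = (κ * κ' - s * s') / R) (h₁₁ : b₁ ⬝ᵥ c₁ = (κ * κ' + s * s') / R)
    (hC : c₀ ⬝ᵥ c₁ = (κ ^ 2 + κ' ^ 2 - R) / R + (κ' ^ 2 - κ ^ 2) / R * C)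
    (hC' : b₀ ⬝ᵥ b₁ = (κ ^ 2 + κ' ^ 2 - R) / R + (κ ^ 2 - κ' ^ 2) / R * C') :
    ((1 - C) * (1 + C') * κ ^ 2 = (1 + C) * (1 - C') * κ' ^ 2 ∧
      b₀ ⬝ᵥ (c₀ ⨯₃ c₁) = -(b₁ ⬝ᵥ (c₀ ⨯₃ c₁)) ∧ c₀ ⬝ᵥ (b₀ ⨯₃ b₁) = -(c₁ ⬝ᵥ (b₀ ⨯₃ b₁))) ∨
    ((1 - C) * (1 + C') * (R - κ ^ 2) = (1 + C) * (1 - C') * (R - κ' ^ 2) ∧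
      b₀ ⬝ᵥ (c₀ ⨯₃ c₁) = b₁ ⬝ᵥ (c₀ ⨯₃ c₁) ∧ c₀ ⬝ᵥ (b₀ ⨯₃ b₁) = c₁ ⬝ᵥ (b₀ ⨯₃ b₁)) := by
  have key := @cross_eq_zero_or_cross_eq_zero (b₀ + b₁) (b₀ - b₁) (c₀ + c₁) (c₀ - c₁)
    (by simp only [add_dotProduct, dotProduct_sub, hb₀, hb₁, dotProduct_comm b₁ b₀]; ring)
    (by simp only [sub_dotProduct, dotProduct_add, h₀₀, h₀₁, h₁₀, h₁₁]; ring)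
    (by simp only [add_dotProduct, dotProduct_sub, h₀₀, h₀₁, h₁₀, h₁₁]; ring)
    (by simp only [add_dotProduct, dotProduct_sub, hc₀, hc₁, dotProduct_comm c₁ c₀]; ring)
  have hne : κ ^ 2 - κ' ^ 2 ≠ 0 := sub_ne_zero.2 hκ
  rcases key with h | h
  · left
    have h2 : (1 + b₀ ⬝ᵥ b₁) * (1 + c₀ ⬝ᵥ c₁) = 4 * (κ * κ' / R) ^ 2 := by
      have := sq_dotProduct_of_cross_eq_zero h
      simp only [add_dotProduct, dotProduct_add, h₀₀, h₀₁, h₁₀, h₁₁, hb₀, hb₁, hc₀, hc₁,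
        dotProduct_comm b₁ b₀, dotProduct_comm c₁ c₀] at this
      linear_combination this / 4
    refine ⟨?_, ?_, ?_⟩
    · rw [hC, hC'] at h2
      field_simp at h2
      apply mul_left_cancel₀ hne
      linear_combination h2
    · have e : (b₀ + b₁) ⬝ᵥ (c₀ ⨯₃ c₁) = -(1 / 2) * ((c₀ - c₁) ⬝ᵥ ((b₀ + b₁) ⨯₃ (c₀ + c₁))) := by
        simp only [cross_apply, Matrix.vec3_dotProduct, Pi.add_apply, Pi.sub_apply,
          Matrix.cons_val]
        ring
      rw [h, dotProduct_zero, add_dotProduct] at e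
      linarith
    · have e : (c₀ + c₁) ⬝ᵥ (b₀ ⨯₃ b₁) = (1 / 2) * ((b₀ - b₁) ⬝ᵥ ((b₀ + b₁) ⨯₃ (c₀ + c₁))) := by
        simp only [cross_apply, Matrix.vec3_dotProduct, Pi.add_apply, Pi.sub_apply,
          Matrix.cons_val]
        ring
      rw [h, dotProduct_zero, add_dotProduct] at e
      linarith
  · right
    have h2 : (1 - b₀ ⬝ᵥ b₁) * (1 - c₀ ⬝ᵥ c₁) = 4 * (s ^ 2 * s' ^ 2) / R ^ 2 := by
      have := sq_dotProduct_of_cross_eq_zero h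
      simp only [sub_dotProduct, dotProduct_sub, h₀₀, h₀₁, h₁₀, h₁₁, hb₀, hb₁, hc₀, hc₁,
        dotProduct_comm b₁ b₀, dotProduct_comm c₁ c₀] at this
      linear_combination this / 4
    rw [show s ^ 2 = R - κ ^ 2 by linarith, show s' ^ 2 = R - κ' ^ 2 by linarith] at h2
    refine ⟨?_, ?_, ?_⟩
    · rw [hC, hC'] at h2
      field_simp at h2
      apply mul_left_cancel₀ hne
      linear_combination -h2
    · have e : (b₀ - b₁) ⬝ᵥ (c₀ ⨯₃ c₁) = (1 / 2) * ((c₀ + c₁) ⬝ᵥ ((b₀ - b₁) ⨯₃ (c₀ - c₁))) := by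
        simp only [cross_apply, Matrix.vec3_dotProduct, Pi.add_apply, Pi.sub_apply,
          Matrix.cons_val]
        ring
      rw [h, dotProduct_zero, sub_dotProduct] at e
      linarith
    · have e : (c₀ - c₁) ⬝ᵥ (b₀ ⨯₃ b₁) = -(1 / 2) * ((b₀ + b₁) ⬝ᵥ ((b₀ - b₁) ⨯₃ (c₀ - c₁))) := by
        simp only [cross_apply, Matrix.vec3_dotProduct, Pi.add_apply, Pi.sub_apply,
          Matrix.cons_val]
        ring
      rw [h, dotProduct_zero, sub_dotProduct] at e
      linarith

/-! ### Newton's theorem for tangential quadrilaterals -/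

/-- The inner product of two vectors of the plane, which is identified with `ℂ`. -/
def dot (z w : ℂ) : ℝ := z.re * w.re + z.im * w.im

/-- The oriented area of the parallelogram spanned by two vectors of the plane `ℂ`. -/
def area (z w : ℂ) : ℝ := z.re * w.im - z.im * w.re

lemma dot_comm (z w : ℂ) : dot z w = dot w z := by
  unfold dot; ring

lemma eq_of_dot_eq {A₀ A₁ B C : ℂ} (hD : area A₀ A₁ ≠ 0) (h₀ : dot A₀ B = dot A₀ C)
    (h₁ : dot A₁ B = dot A₁ C) : B = C := by
  unfold dot at h₀ h₁
  unfold area at hD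
  apply Complex.ext
  · apply mul_left_cancel₀ hD
    linear_combination A₁.im * h₀ - A₀.im * h₁
  · apply mul_left_cancel₀ hD
    linear_combination A₀.re * h₁ - A₁.re * h₀

/-- Newton's theorem for a quadrilateral `A₀B₀A₁B₁` whose sides touch the circle of radius `κ`
centred at the origin, together with its quadratic refinement. The numbers `x i`, `y j` are the
signed tangent lengths of the vertices. In line coordinates, the second part says that the pair of
points `B₀, B₁` belongs to the pencil of conics spanned by the circle and the pair `A₀, A₁`. -/
lemma newton_pencil {A₀ A₁ B₀ B₁ : ℂ} {κ x₀ x₁ y₀ y₁ : ℝ} (hκ : κ ≠ 0)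
    (hA₀ : dot A₀ A₀ = κ ^ 2 + x₀ ^ 2) (hA₁ : dot A₁ A₁ = κ ^ 2 + x₁ ^ 2)
    (hB₀ : dot B₀ B₀ = κ ^ 2 + y₀ ^ 2) (hB₁ : dot B₁ B₁ = κ ^ 2 + y₁ ^ 2)
    (h₀₀ : dot A₀ B₀ = κ ^ 2 - x₀ * y₀) (h₀₁ : dot A₀ B₁ = κ ^ 2 - x₀ * y₁)
    (h₁₀ : dot A₁ B₀ = κ ^ 2 - x₁ * y₀) (h₁₁ : dot A₁ B₁ = κ ^ 2 - x₁ * y₁)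
    (hD : area A₀ A₁ ≠ 0) (hB : B₀ ≠ B₁)
    (hnc : ¬ (area (A₁ - A₀) (B₀ - A₀) = 0 ∧ area (A₁ - A₀) (B₁ - A₀) = 0)) :
    dot A₀ A₁ + κ ^ 2 - x₀ * x₁ ≠ 0 ∧ dot A₀ A₁ - κ ^ 2 - x₀ * x₁ ≠ 0 ∧
    (∀ n, (dot A₀ A₁ + κ ^ 2 - x₀ * x₁) * (dot n B₀ + dot n B₁) =
      2 * κ ^ 2 * (dot n A₀ + dot n A₁)) ∧
    ∀ n, (dot A₀ A₁ + κ ^ 2 - x₀ * x₁) * (dot n B₀ * dot n B₁) =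
      κ ^ 2 * (κ ^ 2 - dot A₀ A₁ + x₀ * x₁) * dot n n + 2 * κ ^ 2 * (dot n A₀ * dot n A₁) := by
  set P := dot A₀ A₁ with hP
  have hD2 : area A₀ A₁ ^ 2 = dot A₀ A₀ * dot A₁ A₁ - P ^ 2 := by
    rw [hP]; unfold dot area; ring
  have hnB : ∀ n B, dot n B * area A₀ A₁ = dot A₀ B * area n A₁ - dot A₁ B * area n A₀ := by
    intro n B; unfold dot area; ring
  have hnn : ∀ n, area A₀ A₁ ^ 2 * dot n n = area n A₁ ^ 2 * dot A₀ A₀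
      - 2 * (area n A₁ * area n A₀ * P) + area n A₀ ^ 2 * dot A₁ A₁ := by
    intro n; rw [hP]; unfold dot area; ring
  have hdotc : dot A₁ A₀ = P := by rw [hP]; unfold dot; ring
  have hy : y₀ - y₁ ≠ 0 := by
    intro h
    have h' : y₀ = y₁ := by linarith
    exact hB (eq_of_dot_eq hD (by rw [h₀₀, h₀₁, h']) (by rw [h₁₀, h₁₁, h']))
  have hP1 : P - κ ^ 2 - x₀ * x₁ ≠ 0 := by
    intro h
    have hcol : ∀ B y, dot A₀ B = κ ^ 2 - x₀ * y → dot A₁ B = κ ^ 2 - x₁ * y →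
        area (A₁ - A₀) (B - A₀) = 0 := by
      intro B y e₀ e₁
      have e : area A₀ A₁ * area (A₁ - A₀) (B - A₀) = P * dot A₀ B - dot A₁ A₁ * dot A₀ B
          - dot A₀ A₀ * dot A₁ B + P * dot A₁ B + area A₀ A₁ ^ 2 := by
        rw [hP]; unfold dot area; simp only [Complex.sub_re, Complex.sub_im]; ring
      have hP' : P = κ ^ 2 + x₀ * x₁ := by linarith
      rw [hD2, e₀, e₁, hA₀, hA₁, hP'] at e
      refine (mul_eq_zero.1 (e.trans ?_)).resolve_left hD
      ring
    exact hnc ⟨hcol _ _ h₀₀ h₁₀, hcol _ _ h₀₁ h₁₁⟩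
  have hquad : ∀ B y, dot A₀ B = κ ^ 2 - x₀ * y → dot A₁ B = κ ^ 2 - x₁ * y →
      dot B B = κ ^ 2 + y ^ 2 → (P + κ ^ 2 - x₀ * x₁) * y ^ 2 + 2 * κ ^ 2 * (x₀ + x₁) * y
        + κ ^ 2 * (P - κ ^ 2 + x₀ * x₁) = 0 := by
    intro B y e₀ e₁ e₂
    have e : area A₀ A₁ ^ 2 * dot B B = dot A₁ A₁ * dot A₀ B ^ 2 + dot A₀ A₀ * dot A₁ B ^ 2
        - 2 * P * dot A₀ B * dot A₁ B := by
      rw [hP]; unfold dot area; ring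
    rw [hD2, e₀, e₁, e₂, hA₀, hA₁] at e
    apply mul_left_cancel₀ hP1
    linear_combination -e
  have q₀ := hquad _ _ h₀₀ h₁₀ hB₀
  have q₁ := hquad _ _ h₀₁ h₁₁ hB₁
  have v₁ : (P + κ ^ 2 - x₀ * x₁) * (y₀ + y₁) = -2 * κ ^ 2 * (x₀ + x₁) := by
    apply mul_left_cancel₀ hy
    linear_combination q₀ - q₁
  have v₂ : (P + κ ^ 2 - x₀ * x₁) * (y₀ * y₁) = κ ^ 2 * (P - κ ^ 2 + x₀ * x₁) := by
    linear_combination y₀ * v₁ - q₀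
  have hκ2 : 0 < κ ^ 2 := by positivity
  refine ⟨?_, hP1, ?_, ?_⟩
  · intro hM
    rw [hM] at v₁ v₂
    have e₁ : x₀ + x₁ = 0 := by
      have : κ ^ 2 * (x₀ + x₁) = 0 := by linarith
      exact (mul_eq_zero.1 this).resolve_left hκ2.ne'
    have e₂ : P - κ ^ 2 + x₀ * x₁ = 0 := by
      have : κ ^ 2 * (P - κ ^ 2 + x₀ * x₁) = 0 := by linarith
      exact (mul_eq_zero.1 this).resolve_left hκ2.ne'
    have e₃ : x₁ = -x₀ := by linarith
    rw [e₃] at e₂ hM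
    nlinarith [sq_nonneg x₀]
  · intro n
    apply mul_left_cancel₀ hD
    have e₀ := hnB n B₀
    have e₁ := hnB n B₁
    have f₀ := hnB n A₀
    have f₁ := hnB n A₁
    rw [h₀₀, h₁₀] at e₀
    rw [h₀₁, h₁₁] at e₁
    rw [hA₀, hdotc] at f₀
    rw [← hP, hA₁] at f₁
    linear_combination (P + κ ^ 2 - x₀ * x₁) * (e₀ + e₁) - 2 * κ ^ 2 * (f₀ + f₁)
      + (-x₀ * area n A₁ + x₁ * area n A₀) * v₁
  · intro n
    apply mul_left_cancel₀ (pow_ne_zero 2 hD)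
    have e₀ := hnB n B₀
    have e₁ := hnB n B₁
    have f₀ := hnB n A₀
    have f₁ := hnB n A₁
    have f₂ := hnn n
    rw [h₀₀, h₁₀] at e₀
    rw [h₀₁, h₁₁] at e₁
    rw [hA₀, hdotc] at f₀
    rw [← hP, hA₁] at f₁
    rw [hA₀, hA₁] at f₂
    have E : area A₀ A₁ ^ 2 * ((P + κ ^ 2 - x₀ * x₁) * (dot n B₀ * dot n B₁)) =
        (P + κ ^ 2 - x₀ * x₁) * ((dot n B₀ * area A₀ A₁) * (dot n B₁ * area A₀ A₁)) := by ring
    have F : area A₀ A₁ ^ 2 * (κ ^ 2 * (κ ^ 2 - P + x₀ * x₁) * dot n n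
        + 2 * κ ^ 2 * (dot n A₀ * dot n A₁)) =
        κ ^ 2 * (κ ^ 2 - P + x₀ * x₁) * (area A₀ A₁ ^ 2 * dot n n) +
        2 * κ ^ 2 * ((dot n A₀ * area A₀ A₁) * (dot n A₁ * area A₀ A₁)) := by ring
    rw [E, F, e₀, e₁, f₀, f₁, f₂]
    linear_combination (-(κ ^ 2 * (area n A₁ - area n A₀)) * (x₀ * area n A₁ - x₁ * area n A₀)) * v₁
      + (x₀ * area n A₁ - x₁ * area n A₀) ^ 2 * v₂

/-! ### Tangents of a circle, and quadrilaterals with sides on tangents -/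

/-- The point at oriented distance `s` from the foot on the line that touches the circle of
radius `κ` about the origin at `κ n`, where `n` is a unit vector. The line is oriented so that the
circle is on its left. -/
def tangentPoint (κ s : ℝ) (n : ℂ) : ℂ := ((κ : ℂ) + s * Complex.I) * n

@[simp] lemma tangentPoint_re (κ s : ℝ) (n : ℂ) :
    (tangentPoint κ s n).re = κ * n.re - s * n.im := by
  simp [tangentPoint]

@[simp] lemma tangentPoint_im (κ s : ℝ) (n : ℂ) :
    (tangentPoint κ s n).im = κ * n.im + s * n.re := by
  simp [tangentPoint]

lemma dot_self_tangentPoint {κ s : ℝ} {n : ℂ} (hn : dot n n = 1) :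
    dot (tangentPoint κ s n) (tangentPoint κ s n) = κ ^ 2 + s ^ 2 := by
  unfold dot at *
  simp only [tangentPoint_re, tangentPoint_im]
  linear_combination (κ ^ 2 + s ^ 2) * hn

lemma dot_tangentPoint {κ s t : ℝ} {n : ℂ} (hn : dot n n = 1) :
    dot (tangentPoint κ s n) (tangentPoint κ t n) = κ ^ 2 + s * t := by
  unfold dot at *
  simp only [tangentPoint_re, tangentPoint_im]
  linear_combination (κ ^ 2 + s * t) * hn

lemma dot_normal_tangentPoint {κ s : ℝ} {n : ℂ} (hn : dot n n = 1) :
    dot n (tangentPoint κ s n) = κ := by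
  unfold dot at *
  simp only [tangentPoint_re, tangentPoint_im]
  linear_combination κ * hn

lemma normal_ne_zero {n : ℂ} (hn : dot n n = 1) : n ≠ 0 := by
  rintro rfl; simp [dot] at hn

lemma tangentPoint_left_injective {κ s : ℝ} {n n' : ℂ} (hκ : 0 < κ)
    (h : tangentPoint κ s n = tangentPoint κ s n') : n = n' := by
  refine mul_left_cancel₀ (fun h0 => ?_) h
  have := congrArg Complex.re h0
  simp at this
  linarith

/-- Through a point pass at most two tangents of a circle, and the oriented distances of the point
from the two points of contact are opposite. -/
lemma offset_eq_neg_or_normal_eq {κ s s' : ℝ} {n n' : ℂ} (hκ : 0 < κ) (hn : dot n n = 1)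
    (hn' : dot n' n' = 1) (h : tangentPoint κ s n = tangentPoint κ s' n') :
    s' = -s ∨ (s' = s ∧ n' = n) := by
  have h2 := dot_self_tangentPoint (κ := κ) (s := s) hn
  rw [h, dot_self_tangentPoint hn'] at h2
  rcases sq_eq_sq_iff_eq_or_eq_neg.1 (show s' ^ 2 = s ^ 2 by linarith) with h3 | h3
  · subst h3
    exact Or.inr ⟨rfl, (tangentPoint_left_injective hκ h).symm⟩
  · exact Or.inl h3

/-- The lines `A i B j` touch the circle of radius `κ` about the origin; `s i j` and `t i j` are
the oriented distances of `A i` and `B j` from the point of contact. -/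
structure TangentQuad (A B : Fin 2 → ℂ) (κ : ℝ) (n : Fin 2 → Fin 2 → ℂ)
    (s t : Fin 2 → Fin 2 → ℝ) : Prop where
  pos : 0 < κ
  unit : ∀ i j, dot (n i j) (n i j) = 1
  left : ∀ i j, A i = tangentPoint κ (s i j) (n i j)
  right : ∀ i j, B j = tangentPoint κ (t i j) (n i j)

lemma TangentQuad.swap {A B : Fin 2 → ℂ} {κ : ℝ} {n : Fin 2 → Fin 2 → ℂ}
    {s t : Fin 2 → Fin 2 → ℝ} (h : TangentQuad A B κ n s t) :
    TangentQuad B A κ (fun j i => n i j) (fun j i => t i j) (fun j i => s i j) :=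
  ⟨h.pos, fun j i => h.unit i j, fun j i => h.right i j, fun j i => h.left i j⟩

/-- The four points `A i`, `B j` do not lie on one line. -/
def NotOnLine (A B : Fin 2 → ℂ) : Prop :=
  ∀ (ν : ℂ) (d : ℝ), ν ≠ 0 → ¬ ∀ i, dot ν (A i) = d ∧ dot ν (B i) = d

lemma NotOnLine.swap {A B : Fin 2 → ℂ} (h : NotOnLine A B) : NotOnLine B A :=
  fun ν d hν h' => h ν d hν fun i => (h' i).symm

/-- If the segments from `V` and from `V'` to `Y₀` and to `Y₁` touch the circle, then the lines
`V Y₀` and `V Y₁` are different, unless `V` is on the circle. On a common line, `Y₀` and `Y₁` would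
be on the same side of the point of contact, and `V'` could only lie on this line as well or on a
second tangent through both of them. -/
lemma offset_eq_neg_of_segment {V V' Y₀ Y₁ n₀ n₁ m₀ m₁ : ℂ} {κ s₀ s₁ t₀ t₁ s₀' s₁' t₀' t₁' : ℝ}
    (hκ : 0 < κ) (hn₀ : dot n₀ n₀ = 1) (hn₁ : dot n₁ n₁ = 1) (hm₀ : dot m₀ m₀ = 1)
    (hm₁ : dot m₁ m₁ = 1)
    (hV₀ : V = tangentPoint κ s₀ n₀) (hV₁ : V = tangentPoint κ s₁ n₁)
    (hV₀' : V' = tangentPoint κ s₀' m₀) (hV₁' : V' = tangentPoint κ s₁' m₁)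
    (hY₀ : Y₀ = tangentPoint κ t₀ n₀) (hY₁ : Y₁ = tangentPoint κ t₁ n₁)
    (hY₀' : Y₀ = tangentPoint κ t₀' m₀) (hY₁' : Y₁ = tangentPoint κ t₁' m₁)
    (h₀ : s₀ * t₀ ≤ 0) (h₁ : s₁ * t₁ ≤ 0) (h₀' : s₀' * t₀' ≤ 0) (h₁' : s₁' * t₁' ≤ 0)
    (hY : Y₀ ≠ Y₁)
    (hnc : ∀ (ν : ℂ) (d : ℝ), ν ≠ 0 → dot ν V = d → dot ν Y₀ = d → dot ν Y₁ = d →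
      dot ν V' ≠ d) : s₁ = -s₀ := by
  rcases offset_eq_neg_or_normal_eq hκ hn₀ hn₁ (hV₀.symm.trans hV₁) with h | ⟨hs, hn⟩
  · exact h
  subst hs hn
  by_contra hs
  have hs0 : s₁ ≠ 0 := by rintro rfl; simp at hs
  have hline : dot n₁ V' ≠ κ := hnc n₁ κ (normal_ne_zero hn₁)
    (by rw [hV₀]; exact dot_normal_tangentPoint hn₁)
    (by rw [hY₀]; exact dot_normal_tangentPoint hn₁)
    (by rw [hY₁]; exact dot_normal_tangentPoint hn₁)
  have hmn₀ : m₀ ≠ n₁ := by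
    rintro rfl; exact hline (by rw [hV₀']; exact dot_normal_tangentPoint hm₀)
  have hmn₁ : m₁ ≠ n₁ := by
    rintro rfl; exact hline (by rw [hV₁']; exact dot_normal_tangentPoint hm₁)
  have e₀ : t₀' = -t₀ :=
    (offset_eq_neg_or_normal_eq hκ hn₁ hm₀ (hY₀.symm.trans hY₀')).resolve_right
      fun h => hmn₀ h.2
  have e₁ : t₁' = -t₁ :=
    (offset_eq_neg_or_normal_eq hκ hn₁ hm₁ (hY₁.symm.trans hY₁')).resolve_right
      fun h => hmn₁ h.2
  have ht₀ : t₀ ≠ 0 := by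
    rintro rfl
    rw [neg_zero] at e₀; subst e₀
    exact hmn₀ (tangentPoint_left_injective hκ (hY₀'.symm.trans hY₀))
  have ht₁ : t₁ ≠ 0 := by
    rintro rfl
    rw [neg_zero] at e₁; subst e₁
    exact hmn₁ (tangentPoint_left_injective hκ (hY₁'.symm.trans hY₁))
  -- `Y₀` and `Y₁` are on the same side of the point of contact, opposite to `V`
  have htt : 0 < t₀ * t₁ := by
    have : 0 ≤ t₀ * t₁ := by
      have h3 : 0 ≤ (s₁ * t₀) * (s₁ * t₁) := mul_nonneg_of_nonpos_of_nonpos h₀ h₁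
      have h4 : 0 < s₁ ^ 2 := by positivity
      by_contra hneg
      push Not at hneg
      nlinarith
    exact lt_of_le_of_ne this (mul_ne_zero ht₀ ht₁).symm
  rw [e₀] at h₀' hY₀'
  rw [e₁] at h₁' hY₁'
  have hss : 0 ≤ s₀' * s₁' := by
    have h3 : 0 ≤ (s₀' * -t₀) * (s₁' * -t₁) := mul_nonneg_of_nonpos_of_nonpos h₀' h₁'
    by_contra hneg
    push Not at hneg
    nlinarith
  have hm : m₁ = m₀ := by
    rcases offset_eq_neg_or_normal_eq hκ hm₀ hm₁ (hV₀'.symm.trans hV₁') with h | h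
    · have h5 : s₀' = 0 := by
        rw [h] at hss; nlinarith [sq_nonneg s₀']
      have h6 : s₁' = s₀' := by rw [h, h5]; simp
      rw [h6] at hV₁'
      exact tangentPoint_left_injective hκ (hV₁'.symm.trans hV₀')
    · exact h.2
  subst hm
  have hne : t₀ - t₁ ≠ 0 := by
    intro h
    have : t₀ = t₁ := by linarith
    exact hY (by rw [hY₀, hY₁, this])
  have a₁ := congrArg Complex.re (hY₀.symm.trans hY₀')
  have a₂ := congrArg Complex.im (hY₀.symm.trans hY₀')
  have b₁ := congrArg Complex.re (hY₁.symm.trans hY₁')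
  have b₂ := congrArg Complex.im (hY₁.symm.trans hY₁')
  simp only [tangentPoint_re, tangentPoint_im] at a₁ a₂ b₁ b₂
  have c₁ : n₁.im = -m₁.im := by
    apply mul_left_cancel₀ hne; linear_combination -(a₁ - b₁)
  have c₂ : n₁.re = -m₁.re := by
    apply mul_left_cancel₀ hne; linear_combination a₂ - b₂
  have d₁ : m₁.re = 0 := by
    rw [c₁, c₂] at a₁
    have : κ * m₁.re = 0 := by linarith
    exact (mul_eq_zero.1 this).resolve_left hκ.ne'
  have d₂ : m₁.im = 0 := by
    rw [c₁, c₂] at a₂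
    have : κ * m₁.im = 0 := by linarith
    exact (mul_eq_zero.1 this).resolve_left hκ.ne'
  simp [dot, d₁, d₂] at hm₁

/-- If the four segments `A i B j` touch the circle, then the two tangents at each vertex are
different lines, unless the vertex is on the circle. -/
lemma TangentQuad.left_offset_of_segment {A B : Fin 2 → ℂ} {κ : ℝ} {n : Fin 2 → Fin 2 → ℂ}
    {s t : Fin 2 → Fin 2 → ℝ} (h : TangentQuad A B κ n s t) (hst : ∀ i j, s i j * t i j ≤ 0)
    (hB : B 0 ≠ B 1) (hnc : NotOnLine A B) (i : Fin 2) : s i 1 = -s i 0 := by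
  have key : ∀ i i' : Fin 2, i ≠ i' → s i 1 = -s i 0 := by
    intro i i' hi
    refine offset_eq_neg_of_segment h.pos (h.unit i 0) (h.unit i 1) (h.unit i' 0) (h.unit i' 1)
      (h.left i 0) (h.left i 1) (h.left i' 0) (h.left i' 1) (h.right i 0) (h.right i 1)
      (h.right i' 0) (h.right i' 1) (hst i 0) (hst i 1) (hst i' 0) (hst i' 1) hB ?_
    intro ν d hν h₁ h₂ h₃ h₄
    refine hnc ν d hν fun k => ⟨?_, ?_⟩
    · rcases (show k = i ∨ k = i' by omega) with rfl | rfl <;> assumption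
    · fin_cases k <;> assumption
  fin_cases i
  · exact key 0 1 (by decide)
  · exact key 1 0 (by decide)

/-- Two opposite sides of the quadrilateral `A 0, C 0, A 1, C 1` cross in their interiors. The
coefficients of the common point need not be normalized. -/
def Crosses (A C : Fin 2 → ℂ) : Prop :=
  ∃ a b a' b' : ℝ, 0 < a ∧ 0 < b ∧ 0 < a' ∧ 0 < b' ∧ a + b = a' + b' ∧
    ((∀ ν, a * dot ν (A 0) + b * dot ν (C 0) = a' * dot ν (A 1) + b' * dot ν (C 1)) ∨
      (∀ ν, a * dot ν (A 0) + b * dot ν (C 1) = a' * dot ν (A 1) + b' * dot ν (C 0)))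

lemma Crosses.swap {A C : Fin 2 → ℂ} (h : Crosses A C) : Crosses C A := by
  obtain ⟨a, b, a', b', ha, hb, ha', hb', hab, h | h⟩ := h
  · exact ⟨b, a, b', a', hb, ha, hb', ha', by linarith, Or.inl fun ν => by linarith [h ν]⟩
  · exact ⟨b', a', b, a, hb', ha', hb, ha, by linarith, Or.inr fun ν => by linarith [h ν]⟩

/-- If three vertices of a self-intersecting quadrilateral lie on a line, so does the fourth. -/
lemma Crosses.dot_eq {A C : Fin 2 → ℂ} (h : Crosses A C) {ν : ℂ} {d : ℝ} {i : Fin 2}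
    (hA : dot ν (A i) = d) (hC : ∀ k, dot ν (C k) = d) (j : Fin 2) : dot ν (A j) = d := by
  obtain ⟨a, b, a', b', ha, hb, ha', hb', hab, h⟩ := h
  have h0 := hC 0
  have h1 := hC 1
  have key : dot ν (A 0) = d ∧ dot ν (A 1) = d := by
    have hb2 : b = a' + b' - a := by linarith
    subst hb2
    have e : a * (dot ν (A 0) - d) = a' * (dot ν (A 1) - d) := by
      rcases h with h | h
      all_goals
        have := h ν
        rw [h0, h1] at this
        linarith
    fin_cases i
    · have hA' : dot ν (A 0) = d := hA
      rw [hA', sub_self, mul_zero] at e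
      have := (mul_eq_zero.1 e.symm).resolve_left ha'.ne'
      exact ⟨hA', by linarith⟩
    · have hA' : dot ν (A 1) = d := hA
      rw [hA', sub_self, mul_zero] at e
      have := (mul_eq_zero.1 e).resolve_left ha.ne'
      exact ⟨by linarith, hA'⟩
  fin_cases j
  · exact key.1
  · exact key.2

lemma TangentQuad.right_ne_of_crosses {A C : Fin 2 → ℂ} {κ : ℝ} {n : Fin 2 → Fin 2 → ℂ}
    {s t : Fin 2 → Fin 2 → ℝ} (h : TangentQuad A C κ n s t) (hX : Crosses A C)
    (hnc : NotOnLine A C) : C 0 ≠ C 1 := by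
  intro he
  have hC : ∀ k, dot (n 0 0) (C k) = κ := by
    have : dot (n 0 0) (C 0) = κ := by
      rw [h.right 0 0]; exact dot_normal_tangentPoint (h.unit 0 0)
    intro k
    fin_cases k
    · exact this
    · rw [he] at this; exact this
  have hA : dot (n 0 0) (A 0) = κ := by
    rw [h.left 0 0]; exact dot_normal_tangentPoint (h.unit 0 0)
  exact hnc _ κ (normal_ne_zero (h.unit 0 0)) fun i => ⟨hX.dot_eq hA hC i, hC i⟩

lemma TangentQuad.left_offset_of_crosses {A C : Fin 2 → ℂ} {κ : ℝ} {n : Fin 2 → Fin 2 → ℂ}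
    {s t : Fin 2 → Fin 2 → ℝ} (h : TangentQuad A C κ n s t) (hX : Crosses A C)
    (hnc : NotOnLine A C) (i : Fin 2) : s i 1 = -s i 0 := by
  rcases offset_eq_neg_or_normal_eq h.pos (h.unit i 0) (h.unit i 1)
    ((h.left i 0).symm.trans (h.left i 1)) with h1 | ⟨-, h1⟩
  · exact h1
  exfalso
  have hC : ∀ k, dot (n i 0) (C k) = κ := by
    intro k
    fin_cases k
    · simp only [Fin.zero_eta]; rw [h.right i 0]; exact dot_normal_tangentPoint (h.unit i 0)
    · simp only [Fin.mk_one]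
      rw [h.right i 1, ← h1]; exact dot_normal_tangentPoint (h.unit i 1)
  have hA : dot (n i 0) (A i) = κ := by
    rw [h.left i 0]; exact dot_normal_tangentPoint (h.unit i 0)
  exact hnc _ κ (normal_ne_zero (h.unit i 0)) fun j => ⟨hX.dot_eq hA hC j, hC j⟩

/-- Opposite vertices of a self-intersecting quadrilateral with sides on tangents of a circle are
not collinear with the centre: otherwise the quadrilateral would be symmetric with respect to the
line through these two vertices. -/
lemma TangentQuad.area_ne_zero_of_crosses {A C : Fin 2 → ℂ} {κ : ℝ} {n : Fin 2 → Fin 2 → ℂ}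
    {s t : Fin 2 → Fin 2 → ℝ} (h : TangentQuad A C κ n s t) (hX : Crosses A C)
    (hnc : NotOnLine A C) : area (A 0) (A 1) ≠ 0 := by
  intro harea
  have hκ := h.pos
  have hA : A 0 ≠ A 1 := h.swap.right_ne_of_crosses hX.swap hnc.swap
  have hC : C 0 ≠ C 1 := h.right_ne_of_crosses hX hnc
  have hs := h.left_offset_of_crosses hX hnc
  have ht : ∀ k, t 1 k = -t 0 k := h.swap.left_offset_of_crosses hX.swap hnc.swap
  have d : ∀ i k, dot (A i) (C k) = κ ^ 2 + s i k * t i k := by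
    intro i k
    conv_lhs => rw [h.left i k, h.right i k]
    exact dot_tangentPoint (h.unit i k)
  have d₀₀ := d 0 0
  have d₀₁ := d 0 1
  have d₁₀ := d 1 0
  have d₁₁ := d 1 1
  rw [hs] at d₀₁
  rw [ht] at d₁₀
  rw [hs, ht] at d₁₁
  have hR : 0 < dot (A 0) (A 0) := by
    rw [h.left 0 0, dot_self_tangentPoint (h.unit 0 0)]; positivity
  have hC0 : dot (C 0) (C 0) = κ ^ 2 + t 0 0 ^ 2 := by
    rw [h.right 0 0, dot_self_tangentPoint (h.unit 0 0)]
  have hC1 : dot (C 1) (C 1) = κ ^ 2 + t 0 1 ^ 2 := by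
    rw [h.right 0 1, dot_self_tangentPoint (h.unit 0 1)]
  -- `A 1` is a multiple of `A 0`
  have hprop : ∀ Z, dot (A 0) (A 0) * dot (A 1) Z = dot (A 0) (A 1) * dot (A 0) Z := by
    intro Z
    have : dot (A 0) (A 0) * dot (A 1) Z - dot (A 0) (A 1) * dot (A 0) Z
        = area (A 0) (A 1) * area (A 0) Z := by unfold dot area; ring
    rw [harea, zero_mul] at this
    linarith
  have p₀ := hprop (C 0)
  have p₁ := hprop (C 1)
  rw [d₀₀, d₁₀] at p₀
  rw [d₀₁, d₁₁] at p₁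
  have hfac : (dot (A 0) (A 1) * s 0 0 + dot (A 0) (A 0) * s 1 0) * (t 0 0 + t 0 1) = 0 := by
    linear_combination p₁ - p₀
  rcases mul_eq_zero.1 hfac with hz | hz
  · have h1 : dot (A 0) (A 1) = dot (A 0) (A 0) := by
      apply mul_left_cancel₀ (pow_ne_zero 2 hκ.ne')
      linear_combination -p₀ - t 0 0 * hz
    apply hA
    have h2 : ∀ Z, dot (A 1) Z = dot (A 0) Z := by
      intro Z
      apply mul_left_cancel₀ hR.ne'
      rw [hprop, h1]
    have h3 := h2 1
    have h4 := h2 Complex.I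
    simp [dot] at h3 h4
    exact Complex.ext h3.symm h4.symm
  · have ht1 : t 0 1 = -t 0 0 := by linarith
    have hdot : dot (A 0) (C 0) = dot (A 0) (C 1) := by rw [d₀₀, d₀₁, ht1]; ring
    have hsq : area (A 0) (C 0) ^ 2 = area (A 0) (C 1) ^ 2 := by
      have e : ∀ Z, area (A 0) Z ^ 2 = dot (A 0) (A 0) * dot Z Z - dot (A 0) Z ^ 2 := by
        intro Z; unfold dot area; ring
      rw [e, e, hdot, hC0, hC1, ht1]; ring
    rcases sq_eq_sq_iff_eq_or_eq_neg.1 hsq with he | he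
    · apply hC
      have e1 : ∀ Z, dot (A 0) (A 0) * Z.re = dot (A 0) Z * (A 0).re - area (A 0) Z * (A 0).im := by
        intro Z; unfold dot area; ring
      have e2 : ∀ Z, dot (A 0) (A 0) * Z.im = dot (A 0) Z * (A 0).im + area (A 0) Z * (A 0).re := by
        intro Z; unfold dot area; ring
      apply Complex.ext
      · apply mul_left_cancel₀ hR.ne'; rw [e1, e1, he, hdot]
      · apply mul_left_cancel₀ hR.ne'; rw [e2, e2, he, hdot]
    · have hν : ∀ Z, dot (Complex.I * A 0) Z = area (A 0) Z := by
        intro Z; simp [dot, area]; ring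
      have hA0 : A 0 ≠ 0 := by intro h0; simp [h0, dot] at hR
      have hself : area (A 0) (A 0) = 0 := by unfold area; ring
      have hC0' : area (A 0) (C 1) = 0 := by
        obtain ⟨a, b, a', b', ha, hb, ha', hb', hab, hX | hX⟩ := hX
        all_goals
          have := hX (Complex.I * A 0)
          simp only [hν, harea, hself, he] at this
          have h5 : (b + b') * area (A 0) (C 1) = 0 := by linarith
          exact (mul_eq_zero.1 h5).resolve_left (by positivity)
      refine hnc (Complex.I * A 0) 0 (mul_ne_zero Complex.I_ne_zero hA0) fun i => ?_
      rw [hν, hν]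
      fin_cases i
      · exact ⟨hself, by simp only [Fin.zero_eta]; rw [he, hC0', neg_zero]⟩
      · exact ⟨harea, hC0'⟩

/-! ### The third circle -/

lemma TangentQuad.dot_left_right {A B : Fin 2 → ℂ} {κ : ℝ} {n : Fin 2 → Fin 2 → ℂ}
    {s t : Fin 2 → Fin 2 → ℝ} (h : TangentQuad A B κ n s t) (i j : Fin 2) :
    dot (A i) (B j) = κ ^ 2 + s i j * t i j := by
  conv_lhs => rw [h.left i j, h.right i j]
  exact dot_tangentPoint (h.unit i j)

lemma TangentQuad.dot_left_self {A B : Fin 2 → ℂ} {κ : ℝ} {n : Fin 2 → Fin 2 → ℂ}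
    {s t : Fin 2 → Fin 2 → ℝ} (h : TangentQuad A B κ n s t) (i j : Fin 2) :
    dot (A i) (A i) = κ ^ 2 + s i j ^ 2 := by
  conv_lhs => rw [h.left i j]
  exact dot_self_tangentPoint (h.unit i j)

lemma TangentQuad.dot_right_self {A B : Fin 2 → ℂ} {κ : ℝ} {n : Fin 2 → Fin 2 → ℂ}
    {s t : Fin 2 → Fin 2 → ℝ} (h : TangentQuad A B κ n s t) (i j : Fin 2) :
    dot (B j) (B j) = κ ^ 2 + t i j ^ 2 :=
  h.swap.dot_left_self j i

lemma TangentQuad.area_sq {A B : Fin 2 → ℂ} {κ : ℝ} {n : Fin 2 → Fin 2 → ℂ}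
    {s t : Fin 2 → Fin 2 → ℝ} (h : TangentQuad A B κ n s t) (i j : Fin 2) :
    area (A i) (B j) ^ 2 = κ ^ 2 * dot (B j - A i) (B j - A i) := by
  have h1 := h.dot_left_right i j
  have h2 := h.dot_left_self i j
  have h3 := h.dot_right_self i j
  have e1 : area (A i) (B j) ^ 2 = dot (A i) (A i) * dot (B j) (B j) - dot (A i) (B j) ^ 2 := by
    unfold dot area; ring
  have e2 : dot (B j - A i) (B j - A i)
      = dot (B j) (B j) + dot (A i) (A i) - 2 * dot (A i) (B j) := by
    unfold dot; simp only [Complex.sub_re, Complex.sub_im]; ring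
  rw [e1, e2, h1, h2, h3]
  ring

lemma dot_sub_self_pos {X Y : ℂ} (h : X ≠ Y) : 0 < dot (Y - X) (Y - X) := by
  have := Complex.normSq_pos.2 (sub_ne_zero.2 h.symm)
  rwa [Complex.normSq_apply] at this

/-- A line at distance `κ > 0` from the origin touches the circle of radius `κ`. -/
lemma exists_tangentPoint {X Y : ℂ} {κ : ℝ} (hκ : 0 < κ) (hXY : X ≠ Y)
    (h : area X Y ^ 2 = κ ^ 2 * dot (Y - X) (Y - X)) :
    ∃ (n : ℂ) (s t : ℝ), dot n n = 1 ∧ X = tangentPoint κ s n ∧ Y = tangentPoint κ t n := by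
  have hD := dot_sub_self_pos hXY
  have ha : area X Y ≠ 0 := by
    intro h0; rw [h0] at h
    have : 0 < κ ^ 2 * dot (Y - X) (Y - X) := by positivity
    linarith [h]
  set l : ℝ := -κ / area X Y with hl
  have hla : l * area X Y = -κ := by rw [hl]; field_simp
  set n : ℂ := ⟨-(l * (Y - X).im), l * (Y - X).re⟩ with hn
  have hre : n.re = -(l * (Y - X).im) := rfl
  have him : n.im = l * (Y - X).re := rfl
  have hunit : dot n n = 1 := by
    have e : dot n n = l ^ 2 * dot (Y - X) (Y - X) := by
      unfold dot; rw [hre, him]; ring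
    rw [e]
    apply mul_left_cancel₀ (pow_ne_zero 2 hκ.ne')
    rw [mul_left_comm, ← h, mul_one, ← mul_pow, hla]; ring
  have hX : dot n X = κ := by
    have e : dot n X = -(l * area X Y) := by
      unfold dot area; rw [hre, him]; simp only [Complex.sub_re, Complex.sub_im]; ring
    rw [e, hla, neg_neg]
  have hY : dot n Y = κ := by
    have e : dot n Y = -(l * area X Y) := by
      unfold dot area; rw [hre, him]; simp only [Complex.sub_re, Complex.sub_im]; ring
    rw [e, hla, neg_neg]
  have hdec : ∀ Z, dot n Z = κ → Z = tangentPoint κ (area n Z) n := by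
    intro Z hZ
    rw [← hZ]
    unfold dot at hunit
    apply Complex.ext
    · simp only [tangentPoint_re]; unfold dot area; linear_combination -Z.re * hunit
    · simp only [tangentPoint_im]; unfold dot area; linear_combination -Z.im * hunit
  exact ⟨n, _, _, hunit, hdec X hX, hdec Y hY⟩

/-- The form of `newton_pencil` used below, with a normalized coefficient. -/
lemma TangentQuad.newton {A B : Fin 2 → ℂ} {κ : ℝ} {n : Fin 2 → Fin 2 → ℂ}
    {s t : Fin 2 → Fin 2 → ℝ} (h : TangentQuad A B κ n s t) (hs : ∀ i, s i 1 = -s i 0)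
    (ht : ∀ j, t 1 j = -t 0 j) (hD : area (A 0) (A 1) ≠ 0) (hB : B 0 ≠ B 1)
    (hnc : NotOnLine A B) :
    ∃ μ : ℝ, μ ≠ 0 ∧ μ ≠ 2 ∧
      (∀ w, μ * (dot w (B 0) + dot w (B 1)) = 2 * (dot w (A 0) + dot w (A 1))) ∧
      ∀ w, μ * (dot w (B 0) * dot w (B 1)) =
        κ ^ 2 * (2 - μ) * dot w w + 2 * (dot w (A 0) * dot w (A 1)) := by
  have hκ := h.pos
  have hκ2 : κ ^ 2 ≠ 0 := by positivity
  have hA : A 0 ≠ A 1 := by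
    intro he; apply hD; rw [he]; unfold area; ring
  have d₀₁ := h.dot_left_right 0 1
  have d₁₀ := h.dot_left_right 1 0
  have d₁₁ := h.dot_left_right 1 1
  rw [hs] at d₀₁
  rw [ht] at d₁₀
  rw [hs, ht] at d₁₁
  obtain ⟨h1, h2, h3, h4⟩ := newton_pencil (A₀ := A 0) (A₁ := A 1) (B₀ := B 0) (B₁ := B 1)
    (x₀ := s 0 0) (x₁ := -s 1 0) (y₀ := -t 0 0) (y₁ := t 0 1) hκ.ne'
    (h.dot_left_self 0 0) (by rw [h.dot_left_self 1 0]; ring)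
    (by rw [h.dot_right_self 0 0]; ring) (h.dot_right_self 0 1)
    (by rw [h.dot_left_right 0 0]; ring) (by rw [d₀₁]; ring) (by rw [d₁₀]; ring)
    (by rw [d₁₁]; ring) hD hB (by
      rintro ⟨e₀, e₁⟩
      have hν : ∀ Z, dot (Complex.I * (A 1 - A 0)) Z = area (A 1 - A 0) Z := by
        intro Z; simp [dot, area]; ring
      have hs : ∀ Z, area (A 1 - A 0) (Z - A 0) = 0 →
          area (A 1 - A 0) Z = area (A 1 - A 0) (A 0) := by
        intro Z hZ
        have : area (A 1 - A 0) (Z - A 0) = area (A 1 - A 0) Z - area (A 1 - A 0) (A 0) := by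
          unfold area; simp only [Complex.sub_re, Complex.sub_im]; ring
        linarith
      refine hnc (Complex.I * (A 1 - A 0)) (area (A 1 - A 0) (A 0))
        (mul_ne_zero Complex.I_ne_zero (sub_ne_zero.2 hA.symm)) fun i => ?_
      rw [hν, hν]
      fin_cases i
      · exact ⟨rfl, hs _ e₀⟩
      · exact ⟨hs (A 1) (by unfold area; simp only [Complex.sub_re, Complex.sub_im]; ring), hs _ e₁⟩)
  set M := dot (A 0) (A 1) + κ ^ 2 - s 0 0 * -s 1 0 with hM
  have hMd : M / κ ^ 2 * κ ^ 2 = M := div_mul_cancel₀ _ hκ2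
  refine ⟨M / κ ^ 2, div_ne_zero h1 hκ2, ?_, ?_, ?_⟩
  · intro he
    rw [div_eq_iff hκ2] at he
    apply h2
    rw [hM] at he
    linarith
  · intro w
    apply mul_left_cancel₀ hκ2
    linear_combination h3 w + (dot w (B 0) + dot w (B 1)) * hMd
  · intro w
    apply mul_left_cancel₀ hκ2
    linear_combination h4 w + (dot w (B 0) * dot w (B 1) + κ ^ 2 * dot w w) * hMd
      - κ ^ 2 * dot w w * hM

/-- A tangent that passes through both `C 0` and `C 1` and through `B j` is a double tangent from
`B j` in the pencil of conics (in line coordinates), so that `B j` is on the circle. -/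
lemma TangentQuad.left_offset_of_pencil {B C : Fin 2 → ℂ} {κ μ μ' ν W : ℝ}
    {n : Fin 2 → Fin 2 → ℂ} {s t : Fin 2 → Fin 2 → ℝ} (h : TangentQuad B C κ n s t) (hν : ν ≠ 0)
    (hp : ∀ w d, μ * ((dot w (B 0) - d) * (dot w (B 1) - d)) -
      μ' * ((dot w (C 0) - d) * (dot w (C 1) - d)) = W * dot w w + ν * d ^ 2) (j : Fin 2) :
    s j 1 = -s j 0 := by
  have hκ := h.pos
  rcases offset_eq_neg_or_normal_eq h.pos (h.unit j 0) (h.unit j 1)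
    ((h.left j 0).symm.trans (h.left j 1)) with h1 | ⟨hs, hn⟩
  · exact h1
  have hu := h.unit j 0
  set m := n j 0 with hm
  set x := s j 0 with hx
  have hB : B j = tangentPoint κ x m := h.left j 0
  have hC0 : C 0 = tangentPoint κ (t j 0) m := h.right j 0
  have hC1 : C 1 = tangentPoint κ (t j 1) m := by rw [h.right j 1, hn]
  have hq : ∀ w, -μ' * ((dot w (C 0) - dot w (B j)) * (dot w (C 1) - dot w (B j))) =
      W * dot w w + ν * dot w (B j) ^ 2 := by
    intro w
    have := hp w (dot w (B j))
    have h0 : (dot w (B 0) - dot w (B j)) * (dot w (B 1) - dot w (B j)) = 0 := by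
      fin_cases j <;> simp
    rw [h0] at this
    linarith
  have hIm : ∀ y, dot (Complex.I * m) (tangentPoint κ y m) = y := by
    intro y; unfold dot at *; simp; linear_combination y * hu
  have hmm : ∀ y, dot (m + Complex.I * m) (tangentPoint κ y m) = κ + y := by
    intro y; unfold dot at *; simp; linear_combination (κ + y) * hu
  have q₁ := hq m
  have q₂ := hq (Complex.I * m)
  have q₃ := hq (m + Complex.I * m)
  rw [hC0, hC1, hB, dot_normal_tangentPoint hu, dot_normal_tangentPoint hu,
    dot_normal_tangentPoint hu, hu] at q₁
  rw [hC0, hC1, hB, hIm, hIm, hIm] at q₂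
  rw [hC0, hC1, hB, hmm, hmm, hmm] at q₃
  have e₂ : dot (Complex.I * m) (Complex.I * m) = 1 := by
    unfold dot at *; simp; linear_combination hu
  have e₃ : dot (m + Complex.I * m) (m + Complex.I * m) = 2 := by
    unfold dot at *; simp; linear_combination 2 * hu
  rw [e₂] at q₂
  rw [e₃] at q₃
  have h0 : ν * (κ * x) = 0 := by linear_combination (-q₁ - q₂ + q₃) * (-1 / 2)
  have hx0 : x = 0 := by
    rcases mul_eq_zero.1 h0 with h0 | h0
    · exact absurd h0 hν
    · exact (mul_eq_zero.1 h0).resolve_left hκ.ne'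
  rw [hs, hx0, neg_zero]

/-- If the sides of `A 0, B 0, A 1, B 1` and of `A 0, C 0, A 1, C 1` lie on tangents of two
concentric circles, then the sides of `B 0, C 0, B 1, C 1` lie on tangents of a third one: in line
coordinates, the pairs `B 0, B 1` and `C 0, C 1` span a pencil of conics that contains a circle
with the same centre. -/
lemma third_circle {A B C : Fin 2 → ℂ} {κ κ' : ℝ} {n n' : Fin 2 → Fin 2 → ℂ}
    {s t s' t' : Fin 2 → Fin 2 → ℝ} (hAB : TangentQuad A B κ n s t)
    (hAC : TangentQuad A C κ' n' s' t') (hκ : κ ^ 2 ≠ κ' ^ 2)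
    (hs : ∀ i, s i 1 = -s i 0) (ht : ∀ j, t 1 j = -t 0 j)
    (hs' : ∀ i, s' i 1 = -s' i 0) (ht' : ∀ k, t' 1 k = -t' 0 k)
    (hA : area (A 0) (A 1) ≠ 0) (hC : area (C 0) (C 1) ≠ 0) (hB : B 0 ≠ B 1)
    (hncB : NotOnLine A B) (hncC : NotOnLine A C) (hne : ∀ j, A 0 ≠ B j) :
    ∃ (κ'' : ℝ) (n'' : Fin 2 → Fin 2 → ℂ) (s'' t'' : Fin 2 → Fin 2 → ℝ),
      TangentQuad B C κ'' n'' s'' t'' ∧ κ'' ^ 2 ≠ κ ^ 2 ∧ κ'' ^ 2 ≠ κ' ^ 2 ∧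
      (∀ j, s'' j 1 = -s'' j 0) ∧ (∀ k, t'' 1 k = -t'' 0 k) ∧ (∀ j k, B j ≠ C k) ∧
      ∃ μ μ' : ℝ, μ ≠ 0 ∧ μ' ≠ 0 ∧
        (∀ w, μ * (dot w (B 0) + dot w (B 1)) = 2 * (dot w (A 0) + dot w (A 1))) ∧
        (∀ w, μ' * (dot w (C 0) + dot w (C 1)) = 2 * (dot w (A 0) + dot w (A 1))) := by
  have hC01 : C 0 ≠ C 1 := by
    intro he; apply hC; rw [he]; unfold area; ring
  obtain ⟨μ, hμ, hμ2, N₁, N₂⟩ := hAB.newton hs ht hA hB hncB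
  obtain ⟨μ', hμ', hμ2', N₁', N₂'⟩ := hAC.newton hs' ht' hA hC01 hncC
  have hBC : ∀ j k, B j ≠ C k := by
    intro j k he
    have e1 := hAB.area_sq 0 j
    have e2 := hAC.area_sq 0 k
    rw [← he, e1] at e2
    exact hκ (mul_right_cancel₀ (dot_sub_self_pos (hne j)).ne' e2)
  set W := κ ^ 2 * (2 - μ) - κ' ^ 2 * (2 - μ') with hW
  set ν := μ - μ' with hν
  have hp : ∀ w d, μ * ((dot w (B 0) - d) * (dot w (B 1) - d)) -
      μ' * ((dot w (C 0) - d) * (dot w (C 1) - d)) = W * dot w w + ν * d ^ 2 := by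
    intro w d
    rw [hW, hν]
    linear_combination N₂ w - N₂' w - d * (N₁ w - N₁' w)
  have hline : ∀ j k, W * dot (C k - B j) (C k - B j) + ν * area (B j) (C k) ^ 2 = 0 := by
    intro j k
    have hd : dot (Complex.I * (C k - B j)) (C k) = dot (Complex.I * (C k - B j)) (B j) := by
      unfold dot; simp; ring
    have h2 := hp (Complex.I * (C k - B j)) (dot (Complex.I * (C k - B j)) (B j))
    have h0 : (dot (Complex.I * (C k - B j)) (B 0) - dot (Complex.I * (C k - B j)) (B j)) *
        (dot (Complex.I * (C k - B j)) (B 1) - dot (Complex.I * (C k - B j)) (B j)) = 0 := by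
      fin_cases j <;> simp
    have h0' : (dot (Complex.I * (C k - B j)) (C 0) - dot (Complex.I * (C k - B j)) (B j)) *
        (dot (Complex.I * (C k - B j)) (C 1) - dot (Complex.I * (C k - B j)) (B j)) = 0 := by
      rw [← hd]; fin_cases k <;> simp
    rw [h0, h0'] at h2
    have e1 : dot (Complex.I * (C k - B j)) (B j) = -area (B j) (C k) := by
      unfold dot area; simp; ring
    have e2 : dot (Complex.I * (C k - B j)) (Complex.I * (C k - B j))
        = dot (C k - B j) (C k - B j) := by
      unfold dot; simp; ring
    rw [e1, e2] at h2
    linarith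
  have hpos : ∀ j k, 0 < dot (C k - B j) (C k - B j) := fun j k => dot_sub_self_pos (hBC j k)
  have hν0 : ν ≠ 0 := by
    intro h0
    have h1 := hline 0 0
    rw [h0, zero_mul, add_zero] at h1
    have h2 := (mul_eq_zero.1 h1).resolve_right (hpos 0 0).ne'
    have h3 : μ' = μ := by linarith
    rw [hW, h3] at h2
    have h4 : (κ ^ 2 - κ' ^ 2) * (2 - μ) = 0 := by linarith
    rcases mul_eq_zero.1 h4 with h4 | h4
    · exact hκ (by linarith)
    · exact hμ2 (by linarith)
  have harea : ∀ j k, area (B j) (C k) ^ 2 = -W / ν * dot (C k - B j) (C k - B j) := by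
    intro j k
    have := hline j k
    field_simp
    linarith
  have hW0 : W ≠ 0 := by
    intro h0
    have a : ∀ k, area (B 0) (C k) = 0 := by
      intro k
      have := harea 0 k
      rw [h0] at this
      simpa using this
    have hB0 : 0 < dot (B 0) (B 0) := by
      rw [hAB.dot_right_self 0 0]; have := hAB.pos; positivity
    apply hC
    apply mul_left_cancel₀ hB0.ne'
    have e : dot (B 0) (B 0) * area (C 0) (C 1) =
        dot (B 0) (C 0) * area (B 0) (C 1) - dot (B 0) (C 1) * area (B 0) (C 0) := by
      unfold dot area; ring
    rw [e, a, a]; ring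
  have hρ : 0 < -W / ν := by
    have h1 : 0 ≤ -W / ν := by
      by_contra hneg
      push Not at hneg
      have := mul_neg_of_neg_of_pos hneg (hpos 0 0)
      rw [← harea] at this
      nlinarith [sq_nonneg (area (B 0) (C 0))]
    exact lt_of_le_of_ne h1 (div_ne_zero (neg_ne_zero.2 hW0) hν0).symm
  have hsq : Real.sqrt (-W / ν) ^ 2 = -W / ν := Real.sq_sqrt hρ.le
  have hex : ∀ j k, ∃ (m : ℂ) (x y : ℝ), dot m m = 1 ∧
      B j = tangentPoint (Real.sqrt (-W / ν)) x m ∧ C k = tangentPoint (Real.sqrt (-W / ν)) y m :=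
    fun j k => exists_tangentPoint (Real.sqrt_pos.2 hρ) (hBC j k) (by rw [hsq, harea])
  choose m x y hm hx hy using hex
  have hq : TangentQuad B C (Real.sqrt (-W / ν)) m x y := ⟨Real.sqrt_pos.2 hρ, hm, hx, hy⟩
  refine ⟨_, m, x, y, hq, ?_, ?_, hq.left_offset_of_pencil hν0 hp, ?_, hBC, μ, μ', hμ, hμ', N₁, N₁'⟩
  · rw [hsq, Ne, div_eq_iff hν0]
    intro he
    have h4 : (κ ^ 2 - κ' ^ 2) * (2 - μ') = 0 := by rw [hW, hν] at he; linarith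
    rcases mul_eq_zero.1 h4 with h4 | h4
    · exact hκ (by linarith)
    · exact hμ2' (by linarith)
  · rw [hsq, Ne, div_eq_iff hν0]
    intro he
    have h4 : (κ ^ 2 - κ' ^ 2) * (2 - μ) = 0 := by rw [hW, hν] at he; linarith
    rcases mul_eq_zero.1 h4 with h4 | h4
    · exact hκ (by linarith)
    · exact hμ2 (by linarith)
  · exact hq.swap.left_offset_of_pencil (μ := μ') (μ' := μ) (ν := -ν) (W := -W)
      (neg_ne_zero.2 hν0) fun w d => by linarith [hp w d]

/-! ### Flat octahedra of type 3 -/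

/-- The data extracted from a flat octahedron of type 3, with the common centre of the circles at
the origin of `ℂ`. The lines of the edges of the `r`-th equator touch a circle of radius `κ r`.
The two tangents at a vertex have opposite offsets (`s_one`, `t_one`). The remaining fields collect
what convexity of the equator `A₁B₁A₂B₂` and self-intersection of `A₁C₁A₂C₂` exclude. -/
structure TangentFrame (X : Fin 3 → Fin 2 → ℂ) (κ : Fin 3 → ℝ) (n : Fin 3 → Fin 2 → Fin 2 → ℂ)
    (s t : Fin 3 → Fin 2 → Fin 2 → ℝ) : Prop where
  quad : ∀ r, TangentQuad (X r) (X (r + 1)) (κ r) (n r) (s r) (t r)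
  s_one : ∀ r i, s r i 1 = -s r i 0
  t_one : ∀ r j, t r 1 j = -t r 0 j
  sq_ne : ∀ r, κ r ^ 2 ≠ κ (r + 1) ^ 2
  ne : ∀ r i j, X r i ≠ X (r + 1) j
  dot_one_ne : dot (X 1 0) (X 1 0) ≠ dot (X 1 1) (X 1 1)
  s_zero_add : dot (X 0 0) (X 0 0) = dot (X 0 1) (X 0 1) → s 0 0 0 + s 0 1 0 = 0
  t_one_add : dot (X 2 0) (X 2 0) = dot (X 2 1) (X 2 1) → t 1 0 0 + t 1 0 1 = 0
  s_two_eq : dot (X 2 0) (X 2 0) = dot (X 2 1) (X 2 1) → s 2 0 0 = s 2 1 0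
  t_two_eq : dot (X 0 0) (X 0 0) = dot (X 0 1) (X 0 1) → t 2 0 0 = t 2 0 1

/-- The plane as `ℂ`, with the origin at `o`. -/
def toComplex (o x : Plane) : ℂ := ⟨x 0 - o 0, x 1 - o 1⟩

@[simp] lemma toComplex_re (o x : Plane) : (toComplex o x).re = x 0 - o 0 := rfl

@[simp] lemma toComplex_im (o x : Plane) : (toComplex o x).im = x 1 - o 1 := rfl

lemma toComplex_injective (o : Plane) : Function.Injective (toComplex o) := by
  intro x y h
  have h1 := congrArg Complex.re h
  have h2 := congrArg Complex.im h
  simp only [toComplex_re, toComplex_im] at h1 h2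
  ext i
  fin_cases i
  · simpa using h1
  · simpa using h2

lemma dist_sq_eq_dot (o x y : Plane) : dist x y ^ 2 =
    dot (toComplex o y - toComplex o x) (toComplex o y - toComplex o x) := by
  rw [EuclideanSpace.dist_eq, Real.sq_sqrt (Finset.sum_nonneg fun i _ => sq_nonneg _)]
  simp [Fin.sum_univ_two, Real.dist_eq, sq_abs, dot]
  ring

lemma inner_sub_sub_eq_dot (o x y z : Plane) : ⟪x - z, y - o⟫ =
    dot (toComplex o x - toComplex o z) (toComplex o y) := by
  simp [PiLp.inner_apply, Fin.sum_univ_two, dot]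
  ring

lemma dot_toComplex_of_add_eq {o x y : Plane} {a b : ℝ} (ν : ℂ) (hab : a + b = 1) :
    dot ν (toComplex o (a • x + b • y)) = a * dot ν (toComplex o x) + b * dot ν (toComplex o y) := by
  have hb : b = 1 - a := by linarith
  subst hb
  simp [dot]
  ring

/-- A tangent of a circle in the sense of Mathlib, in the coordinates of `tangentPoint`; the last
two points are arbitrary points of the line. -/
lemma exists_tangentPoint_of_isTangentAt {K : EuclideanGeometry.Sphere Plane} {c x y : Plane}
    (hK : 0 < K.radius) (h : K.IsTangentAt c line[ℝ, x, y]) :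
    ∃ (n : ℂ) (s t : ℝ), dot n n = 1 ∧ toComplex K.center c = tangentPoint K.radius 0 n ∧
      toComplex K.center x = tangentPoint K.radius s n ∧
      toComplex K.center y = tangentPoint K.radius t n := by
  have hc : dot (toComplex K.center c) (toComplex K.center c) = K.radius ^ 2 := by
    have h1 := dist_sq_eq_dot K.center K.center c
    rw [dist_comm, EuclideanGeometry.mem_sphere.1 h.mem_sphere] at h1
    rw [h1]; simp [dot]
  have horth : ∀ z ∈ line[ℝ, x, y],
      dot (toComplex K.center z - toComplex K.center c) (toComplex K.center c) = 0 := by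
    intro z hz
    have h1 := EuclideanGeometry.Sphere.mem_orthRadius_iff_inner_left.1 (h.le_orthRadius hz)
    rw [vsub_eq_sub, vsub_eq_sub, inner_sub_sub_eq_dot] at h1
    exact h1
  set w := toComplex K.center c with hw
  set ρ := K.radius with hρ
  have hne : ρ ≠ 0 := hK.ne'
  set n : ℂ := ⟨w.re / ρ, w.im / ρ⟩ with hn
  have hre : n.re * ρ = w.re := by simp [hn, hne]
  have him : n.im * ρ = w.im := by simp [hn, hne]
  have hunit : dot n n = 1 := by
    apply mul_left_cancel₀ (pow_ne_zero 2 hne)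
    have : ρ ^ 2 * dot n n = dot w w := by unfold dot; rw [← hre, ← him]; ring
    rw [mul_one, this, hc]
  have key : ∀ z ∈ line[ℝ, x, y],
      toComplex K.center z = tangentPoint ρ (area n (toComplex K.center z)) n := by
    intro z hz
    have h1 := horth z hz
    have h2 : dot (toComplex K.center z) n = ρ := by
      apply mul_right_cancel₀ hne
      have : dot (toComplex K.center z) n * ρ = dot (toComplex K.center z) w := by
        unfold dot; rw [← hre, ← him]; ring
      rw [this]
      have h3 : dot (toComplex K.center z - w) w = dot (toComplex K.center z) w - dot w w := by
        unfold dot; simp only [Complex.sub_re, Complex.sub_im]; ring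
      rw [h1, hc] at h3
      linarith
    rw [← h2]
    unfold dot at hunit
    apply Complex.ext
    · simp only [tangentPoint_re]; unfold dot area
      linear_combination -(toComplex K.center z).re * hunit
    · simp only [tangentPoint_im]; unfold dot area
      linear_combination -(toComplex K.center z).im * hunit
  refine ⟨n, _, _, hunit, ?_, key x (left_mem_affineSpan_pair ℝ x y),
    key y (right_mem_affineSpan_pair ℝ x y)⟩
  apply Complex.ext
  · simp only [tangentPoint_re]; linarith
  · simp only [tangentPoint_im]; linarith

/-- If the point of contact belongs to the segment, then the offsets of the end points do not
have the same sign. -/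
lemma exists_tangentPoint_of_segmentTangent {K : EuclideanGeometry.Sphere Plane} {x y : Plane}
    (hK : 0 < K.radius) (h : SegmentTangent K x y) :
    ∃ (n : ℂ) (s t : ℝ), dot n n = 1 ∧ s * t ≤ 0 ∧
      toComplex K.center x = tangentPoint K.radius s n ∧
      toComplex K.center y = tangentPoint K.radius t n := by
  obtain ⟨c, ⟨a, b, ha, hb, hab, rfl⟩, hc⟩ := h
  obtain ⟨n, s, t, hn, h0, hx, hy⟩ := exists_tangentPoint_of_isTangentAt hK hc
  refine ⟨n, s, t, hn, ?_, hx, hy⟩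
  have h1 := dot_toComplex_of_add_eq (o := K.center) (x := x) (y := y) (Complex.I * n) hab
  have hI : ∀ u, dot (Complex.I * n) (tangentPoint K.radius u n) = u := by
    intro u; unfold dot at *; simp; linear_combination u * hn
  rw [h0, hx, hy, hI, hI, hI] at h1
  -- `a s + b t = 0` with `a, b ≥ 0`
  have e1 : a * (s * t) = -(b * t ^ 2) := by linear_combination -t * h1
  have e2 : b * (s * t) = -(a * s ^ 2) := by linear_combination -s * h1
  have e3 : s * t = -(b * t ^ 2) - a * s ^ 2 := by
    linear_combination e1 + e2 - s * t * hab
  nlinarith [mul_nonneg hb (sq_nonneg t), mul_nonneg ha (sq_nonneg s)]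

lemma notOnLine_of_not_collinear {o : Plane} {x y z w : Plane}
    (h : ¬ Collinear ℝ {x, y, z, w}) {A B : Fin 2 → ℂ} (hA₀ : A 0 = toComplex o x)
    (hA₁ : A 1 = toComplex o z) (hB₀ : B 0 = toComplex o y) (hB₁ : B 1 = toComplex o w) :
    NotOnLine A B := by
  intro ν d hν hall
  apply h
  have hν2 : 0 < dot ν ν := by
    have := Complex.normSq_pos.2 hν
    rwa [Complex.normSq_apply] at this
  have hx : dot ν (toComplex o x) = d := by rw [← hA₀]; exact (hall 0).1
  rw [collinear_iff_of_mem (p₀ := x) (by simp)]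
  refine ⟨!₂[-ν.im, ν.re], fun q hq => ?_⟩
  have hqd : dot ν (toComplex o q) = d := by
    rcases hq with rfl | rfl | rfl | rfl
    · exact hx
    · rw [← hB₀]; exact (hall 0).2
    · rw [← hA₁]; exact (hall 1).1
    · rw [← hB₁]; exact (hall 1).2
  refine ⟨area ν (toComplex o q - toComplex o x) / dot ν ν, ?_⟩
  have hdiff : dot ν (toComplex o q) - dot ν (toComplex o x) = 0 := by rw [hqd, hx, sub_self]
  unfold dot at hdiff
  simp only [toComplex_re, toComplex_im] at hdiff
  rw [vadd_eq_add]
  ext i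
  fin_cases i
  · simp
    rw [div_mul_eq_mul_div, ← sub_eq_iff_eq_add, ← neg_div, eq_div_iff hν2.ne']
    unfold area dot
    simp only [Complex.sub_re, Complex.sub_im, toComplex_re, toComplex_im]
    linear_combination ν.re * hdiff
  · simp
    rw [div_mul_eq_mul_div, ← sub_eq_iff_eq_add, eq_div_iff hν2.ne']
    unfold area dot
    simp only [Complex.sub_re, Complex.sub_im, toComplex_re, toComplex_im]
    linear_combination ν.im * hdiff

lemma crosses_of_isSelfIntersecting {o : Plane} {x y z w : Plane}
    (h : IsSelfIntersectingQuadrilateral x y z w) {A C : Fin 2 → ℂ} (hA₀ : A 0 = toComplex o x)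
    (hA₁ : A 1 = toComplex o z) (hC₀ : C 0 = toComplex o y) (hC₁ : C 1 = toComplex o w) :
    Crosses A C := by
  rcases h.2 with ⟨q, ⟨a, b, ha, hb, hab, h1⟩, ⟨a', b', ha', hb', hab', h2⟩⟩ |
    ⟨q, ⟨a, b, ha, hb, hab, h1⟩, ⟨a', b', ha', hb', hab', h2⟩⟩
  · refine ⟨a, b, a', b', ha, hb, ha', hb', by linarith, Or.inl fun ν => ?_⟩
    rw [hA₀, hA₁, hC₀, hC₁, ← dot_toComplex_of_add_eq ν hab, ← dot_toComplex_of_add_eq ν hab',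
      h1, h2]
  · refine ⟨b', a', b, a, hb', ha', hb, ha, by linarith, Or.inr fun ν => ?_⟩
    rw [hA₀, hA₁, hC₀, hC₁, add_comm (b' * _), add_comm (b * _), ← dot_toComplex_of_add_eq ν hab,
      ← dot_toComplex_of_add_eq ν hab', h1, h2]

lemma ne_of_isConvexQuadrilateral {x y z w : Plane} (h : IsConvexQuadrilateral x y z w) :
    y ≠ w := by
  rintro rfl
  obtain ⟨q, hq, hq'⟩ := h.2
  rw [segment_same, Set.mem_singleton_iff] at hq'
  subst hq'
  apply h.1.2.2.2.2
  have := (mem_segment_iff_wbtw.1 hq).collinear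
  have hs : ({x, q, z, q} : Set Plane) = {x, q, z} := by
    ext; simp; tauto
  rwa [hs]

/-- Every flat octahedron of type 3 has the data of a `TangentFrame`. The opposite vertices
`B₁, B₂` of the convex equator are not equidistant from the centre, because its sides touch the
circle at their points. For the other two classes, the symmetric position is restricted by the
linear part of `TangentQuad.newton` and by not being collinear with the centre. -/
lemma IsFlatType3.exists_tangentFrame {p : Placement Plane} (hp : IsFlatType3 p) :
    ∃ X κ n s t, TangentFrame X κ n s t ∧ ∀ r i j, dist (p r i) (p (r + 1) j) ^ 2 =
      dot (X (r + 1) j - X r i) (X (r + 1) j - X r i) := by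
  obtain ⟨K', K, hK, hcen, hK', hK0, hconv, htan, hself, htan'⟩ := hp
  set o := K.center with ho
  have hrad : K.radius ^ 2 ≠ K'.radius ^ 2 := by
    intro he
    apply hK
    ext1
    · exact hcen
    · exact ((sq_eq_sq₀ hK0.le hK'.le).1 he).symm
  set X : Fin 3 → Fin 2 → ℂ := fun r i => toComplex o (p r i) with hX
  have h1 := fun i j => exists_tangentPoint_of_segmentTangent hK0 (htan i j)
  choose n s t hn hst hs ht using h1
  have h2 : ∀ i k, ∃ (n : ℂ) (s t : ℝ), dot n n = 1 ∧
      toComplex o (p 0 i) = tangentPoint K'.radius s n ∧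
      toComplex o (p 2 k) = tangentPoint K'.radius t n := by
    intro i k
    obtain ⟨c, hc⟩ := htan' i k
    obtain ⟨n, s, t, h1, -, h2, h3⟩ := exists_tangentPoint_of_isTangentAt hK' hc
    rw [hcen] at h2 h3
    exact ⟨n, s, t, h1, h2, h3⟩
  choose n' s' t' hn' hs' ht' using h2
  have qAB : TangentQuad (X 0) (X 1) K.radius n s t := ⟨hK0, hn, hs, ht⟩
  have qAC : TangentQuad (X 0) (X 2) K'.radius n' s' t' := ⟨hK', hn', hs', ht'⟩
  have ncB : NotOnLine (X 0) (X 1) := notOnLine_of_not_collinear hconv.1.2.2.2.2 rfl rfl rfl rfl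
  have ncC : NotOnLine (X 0) (X 2) := notOnLine_of_not_collinear hself.1.2.2.2.2 rfl rfl rfl rfl
  have hcr : Crosses (X 0) (X 2) := crosses_of_isSelfIntersecting hself rfl rfl rfl rfl
  have hA : area (X 0 0) (X 0 1) ≠ 0 := qAC.area_ne_zero_of_crosses hcr ncC
  have hC : area (X 2 0) (X 2 1) ≠ 0 := qAC.swap.area_ne_zero_of_crosses hcr.swap ncC.swap
  have hA01 : X 0 0 ≠ X 0 1 := qAC.swap.right_ne_of_crosses hcr.swap ncC.swap
  have hC01 : X 2 0 ≠ X 2 1 := qAC.right_ne_of_crosses hcr ncC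
  have hB01 : X 1 0 ≠ X 1 1 := fun h => ne_of_isConvexQuadrilateral hconv (toComplex_injective o h)
  have hs1 := qAB.left_offset_of_segment hst hB01 ncB
  have ht1 : ∀ j, t 1 j = -t 0 j := qAB.swap.left_offset_of_segment
    (fun j i => by rw [mul_comm]; exact hst i j) hA01 ncB.swap
  have hs1' := qAC.left_offset_of_crosses hcr ncC
  have ht1' : ∀ k, t' 1 k = -t' 0 k := qAC.swap.left_offset_of_crosses hcr.swap ncC.swap
  obtain ⟨hq1, hq2, hq3, hq4, -⟩ := hconv.1
  obtain ⟨hr1, hr2, hr3, hr4, -⟩ := hself.1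
  have neAB : ∀ i j, X 0 i ≠ X 1 j := by
    intro i j h
    have h := toComplex_injective o h
    fin_cases i <;> fin_cases j
    · exact hq1 h
    · exact hq4 h.symm
    · exact hq2 h.symm
    · exact hq3 h
  have neAC : ∀ i j, X 0 i ≠ X 2 j := by
    intro i j h
    have h := toComplex_injective o h
    fin_cases i <;> fin_cases j
    · exact hr1 h
    · exact hr4 h.symm
    · exact hr2 h.symm
    · exact hr3 h
  obtain ⟨κ, n'', s'', t'', qBC, hκ, hκ', hs1'', ht1'', neBC, μ, μ', hμ, hμ', N, N'⟩ :=
    third_circle qAB qAC hrad hs1 ht1 hs1' ht1' hA hC hB01 ncB ncC (neAB 0)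
  -- inner products of vertices on the equator `AB`
  have d₀₀ := qAB.dot_left_right 0 0
  have d₀₁ := qAB.dot_left_right 0 1
  have d₁₀ := qAB.dot_left_right 1 0
  have d₁₁ := qAB.dot_left_right 1 1
  rw [hs1] at d₀₁
  rw [ht1] at d₁₀
  rw [hs1, ht1] at d₁₁
  have e₀₀ := qAC.dot_left_right 0 0
  have e₀₁ := qAC.dot_left_right 0 1
  have e₁₀ := qAC.dot_left_right 1 0
  have e₁₁ := qAC.dot_left_right 1 1
  rw [hs1'] at e₀₁
  rw [ht1'] at e₁₀
  rw [hs1', ht1'] at e₁₁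
  have f₀₀ := qBC.dot_left_right 0 0
  have f₀₁ := qBC.dot_left_right 0 1
  have f₁₀ := qBC.dot_left_right 1 0
  have f₁₁ := qBC.dot_left_right 1 1
  rw [hs1''] at f₀₁
  rw [ht1''] at f₁₀
  rw [hs1'', ht1''] at f₁₁
  have hsub : ∀ x y z : ℂ, dot (x - y) z = dot x z - dot y z := by
    intro x y z; unfold dot; simp only [Complex.sub_re, Complex.sub_im]; ring
  have hmid : dot (X 1 0) (X 1 0) ≠ dot (X 1 1) (X 1 1) := by
    intro h
    have g₀₀ := hst 0 0
    have g₀₁ := hst 0 1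
    have g₁₀ := hst 1 0
    have g₁₁ := hst 1 1
    rw [hs1] at g₀₁
    rw [ht1] at g₁₀
    rw [hs1, ht1] at g₁₁
    rw [qAB.dot_right_self 0 0, qAB.dot_right_self 0 1] at h
    apply hB01
    have hor := sq_eq_sq_iff_eq_or_eq_neg.1 (add_left_cancel h)
    refine eq_of_dot_eq hA ?_ ?_
    · rw [d₀₀, d₀₁]
      rcases hor with hor | hor <;> rw [hor] at g₀₀ g₁₀ ⊢
      · linarith
      · ring
    · rw [d₁₀, d₁₁]
      rcases hor with hor | hor <;> rw [hor] at g₀₀ g₁₀ ⊢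
      · linarith
      · ring
  refine ⟨X, ![K.radius, κ, K'.radius], ![n, n'', fun k i => n' i k], ![s, s'', fun k i => t' i k],
    ![t, t'', fun k i => s' i k], ?_, fun r i j => dist_sq_eq_dot o _ _⟩
  constructor
  · intro r
    fin_cases r
    · exact qAB
    · exact qBC
    · exact qAC.swap
  · intro r i
    fin_cases r
    · exact hs1 i
    · exact hs1'' i
    · exact ht1' i
  · intro r i
    fin_cases r
    · exact ht1 i
    · exact ht1'' i
    · exact hs1' i
  · intro r
    fin_cases r
    · exact hκ.symm
    · exact hκ'
    · exact hrad.symm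
  · intro r i j
    fin_cases r
    · exact neAB i j
    · exact neBC i j
    · exact (neAC j i).symm
  · exact hmid
  · intro h
    show s 0 0 + s 1 0 = 0
    have h1 := N (X 0 0 - X 0 1)
    simp only [hsub, d₀₀, d₀₁, d₁₀, d₁₁, h, dot_comm (X 0 1) (X 0 0)] at h1
    have h2 : μ * ((s 0 0 + s 1 0) * (t 0 0 - t 0 1)) = 0 := by linarith
    rcases mul_eq_zero.1 ((mul_eq_zero.1 h2).resolve_left hμ) with h3 | h3
    · exact h3
    · exfalso; apply hmid
      rw [qAB.dot_right_self 0 0, qAB.dot_right_self 0 1, sub_eq_zero.1 h3]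
  · intro h
    show t'' 0 0 + t'' 0 1 = 0
    have h1 := (N (X 2 0 - X 2 1)).trans (N' (X 2 0 - X 2 1)).symm
    simp only [hsub, h, dot_comm (X 2 1) (X 2 0), dot_comm (X 2 _) (X 1 _), f₀₀, f₀₁, f₁₀, f₁₁] at h1
    have h2 : μ * ((s'' 0 0 - s'' 1 0) * (t'' 0 0 + t'' 0 1)) = 0 := by linarith
    rcases mul_eq_zero.1 ((mul_eq_zero.1 h2).resolve_left hμ) with h3 | h3
    · exfalso; apply hmid
      rw [qBC.dot_left_self 0 0, qBC.dot_left_self 1 0, sub_eq_zero.1 h3]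
    · exact h3
  · intro h
    show t' 0 0 = t' 0 1
    rw [qAC.dot_right_self 0 0, qAC.dot_right_self 0 1] at h
    rcases sq_eq_sq_iff_eq_or_eq_neg.1 (add_left_cancel h) with h | h
    · exact h
    · exfalso
      exact hC01 (eq_of_dot_eq hA (by rw [e₀₀, e₀₁, h]; ring) (by rw [e₁₀, e₁₁, h]; ring))
  · intro h
    show s' 0 0 = s' 1 0
    rw [qAC.dot_left_self 0 0, qAC.dot_left_self 1 0] at h
    rcases sq_eq_sq_iff_eq_or_eq_neg.1 (add_left_cancel h) with h | h
    · exact h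
    · exfalso
      refine hA01 (eq_of_dot_eq hC ?_ ?_)
      · rw [dot_comm, dot_comm (X 2 0), e₀₀, e₁₀, h]; ring
      · rw [dot_comm, dot_comm (X 2 1), e₀₁, e₁₁, h]; ring

/-! ### The link of a vertex -/

lemma space_inner_eq (x y : Space) : ⟪x, y⟫ = x.ofLp ⬝ᵥ y.ofLp := by
  rw [EuclideanSpace.inner_eq_star_dotProduct]
  simp [dotProduct_comm]

lemma ofLp_cross (x y : Space) : (cross x y).ofLp = x.ofLp ⨯₃ y.ofLp := rfl

/-- The cosine of the dihedral angle at an edge, measured between the half-planes that contain the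
centre of the circles when the adjacent faces are placed in the flat position. Here `A` is a point
of the edge, `Z₀` and `Z₁` are the opposite vertices of the adjacent faces, `a`, `z₀`, `z₁` are
their flat positions and `n` is the unit normal of the edge in the flat position. -/
def edgeCos (A Z₀ Z₁ : Space) (a z₀ z₁ n : ℂ) : ℝ :=
  (⟪Z₀ - A, Z₁ - A⟫ - dot (Complex.I * n) (z₀ - a) * dot (Complex.I * n) (z₁ - a)) /
    (dot n (a - z₀) * dot n (a - z₁))

/-- The sine of the dihedral angle at the edge from `A` to `B`, with the conventions of `edgeCos`;
the edge is oriented like the corresponding tangent in the flat position. -/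
def edgeSin (A B Z₀ Z₁ : Space) (a b z₀ z₁ n : ℂ) : ℝ :=
  ⟪B - A, cross (Z₀ - A) (Z₁ - A)⟫ /
    (dot (Complex.I * n) (b - a) * (dot n (a - z₀) * dot n (a - z₁)))

section Plane

variable {v : ℂ} {κ κ' s σ : ℝ} {n m : ℂ}

lemma dot_normal_normal (hκ : 0 < κ) (hn : dot n n = 1) (hm : dot m m = 1)
    (h : v = tangentPoint κ s n) (h' : v = tangentPoint κ' σ m) :
    dot n m = (κ * κ' + s * σ) / dot v v ∧
      dot n (Complex.I * m) = (κ * σ - s * κ') / dot v v := by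
  have hR : dot v v = κ ^ 2 + s ^ 2 := by rw [h]; exact dot_self_tangentPoint hn
  have hR' : dot v v = κ' ^ 2 + σ ^ 2 := by rw [h']; exact dot_self_tangentPoint hm
  have hpos : dot v v ≠ 0 := by rw [hR]; positivity
  have hre := congrArg Complex.re h
  have him := congrArg Complex.im h
  have hre' := congrArg Complex.re h'
  have him' := congrArg Complex.im h'
  simp only [tangentPoint_re, tangentPoint_im] at hre him hre' him'
  have a₁ : dot v v * n.re = κ * v.re + s * v.im := by rw [hR, hre, him]; ring
  have a₂ : dot v v * n.im = κ * v.im - s * v.re := by rw [hR, hre, him]; ring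
  have b₁ : dot v v * m.re = κ' * v.re + σ * v.im := by rw [hR', hre', him']; ring
  have b₂ : dot v v * m.im = κ' * v.im - σ * v.re := by rw [hR', hre', him']; ring
  have hI : dot n (Complex.I * m) = n.im * m.re - n.re * m.im := by unfold dot; simp; ring
  constructor
  · rw [eq_div_iff hpos]
    apply mul_right_cancel₀ hpos
    have : dot n m * dot v v * dot v v =
        (dot v v * n.re) * (dot v v * m.re) + (dot v v * n.im) * (dot v v * m.im) := by
      rw [show dot n m = n.re * m.re + n.im * m.im from rfl]; ring
    rw [this, a₁, a₂, b₁, b₂, show dot v v = v.re * v.re + v.im * v.im from rfl]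
    ring
  · rw [eq_div_iff hpos, hI]
    apply mul_right_cancel₀ hpos
    have : (n.im * m.re - n.re * m.im) * dot v v * dot v v =
        (dot v v * n.im) * (dot v v * m.re) - (dot v v * n.re) * (dot v v * m.im) := by ring
    rw [this, a₁, a₂, b₁, b₂, show dot v v = v.re * v.re + v.im * v.im from rfl]
    ring

lemma dot_direction_sub (w : ℂ) (t : ℝ) :
    dot w (tangentPoint κ t n - tangentPoint κ s n) = (t - s) * dot w (Complex.I * n) := by
  unfold dot
  simp
  ring

lemma dot_I_mul_I_mul (z w : ℂ) : dot (Complex.I * z) (Complex.I * w) = dot z w := by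
  unfold dot; simp; ring

end Plane

/-- At each vertex `V` of the octahedron the cosines of opposite dihedral angles coincide, and the
link of `V` belongs to one of two families, distinguished by the sign that relates the sines of
opposite dihedral angles. -/
lemma vertex_dichotomy {V : Space} {Y Z : Fin 2 → Space} {v : ℂ} {y z n m : Fin 2 → ℂ}
    {κ κ' : ℝ} {s t s' t' : Fin 2 → ℝ} (hκ : 0 < κ) (hκκ' : κ ^ 2 ≠ κ' ^ 2)
    (hn : ∀ j, dot (n j) (n j) = 1) (hm : ∀ k, dot (m k) (m k) = 1)
    (hv : ∀ j, v = tangentPoint κ (s j) (n j)) (hy : ∀ j, y j = tangentPoint κ (t j) (n j))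
    (hz : ∀ k, z k = tangentPoint κ' (s' k) (m k)) (hv' : ∀ k, v = tangentPoint κ' (t' k) (m k))
    (hs : s 1 = -s 0) (ht' : t' 1 = -t' 0) (hvy : ∀ j, v ≠ y j) (hzv : ∀ k, z k ≠ v)
    (hVY : ∀ j, dist V (Y j) ^ 2 = dot (y j - v) (y j - v))
    (hZV : ∀ k, dist (Z k) V ^ 2 = dot (v - z k) (v - z k))
    (hYZ : ∀ j k, dist (Y j) (Z k) ^ 2 = dot (z k - y j) (z k - y j)) :
    (∀ j, dot (n j) (v - z 0) ≠ 0 ∧ dot (n j) (v - z 1) ≠ 0) ∧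
    edgeCos V (Z 0) (Z 1) v (z 0) (z 1) (n 1) = edgeCos V (Z 0) (Z 1) v (z 0) (z 1) (n 0) ∧
    edgeCos (Z 1) (Y 0) (Y 1) (z 1) (y 0) (y 1) (m 1) =
      edgeCos (Z 0) (Y 0) (Y 1) (z 0) (y 0) (y 1) (m 0) ∧
    (((1 - edgeCos V (Z 0) (Z 1) v (z 0) (z 1) (n 0)) *
        (1 + edgeCos (Z 0) (Y 0) (Y 1) (z 0) (y 0) (y 1) (m 0)) * κ ^ 2 =
      (1 + edgeCos V (Z 0) (Z 1) v (z 0) (z 1) (n 0)) *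
        (1 - edgeCos (Z 0) (Y 0) (Y 1) (z 0) (y 0) (y 1) (m 0)) * κ' ^ 2 ∧
      edgeSin V (Y 0) (Z 0) (Z 1) v (y 0) (z 0) (z 1) (n 0) =
        -edgeSin V (Y 1) (Z 0) (Z 1) v (y 1) (z 0) (z 1) (n 1) ∧
      edgeSin (Z 0) V (Y 0) (Y 1) (z 0) v (y 0) (y 1) (m 0) =
        -edgeSin (Z 1) V (Y 0) (Y 1) (z 1) v (y 0) (y 1) (m 1)) ∨
     ((1 - edgeCos V (Z 0) (Z 1) v (z 0) (z 1) (n 0)) *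
        (1 + edgeCos (Z 0) (Y 0) (Y 1) (z 0) (y 0) (y 1) (m 0)) * (dot v v - κ ^ 2) =
      (1 + edgeCos V (Z 0) (Z 1) v (z 0) (z 1) (n 0)) *
        (1 - edgeCos (Z 0) (Y 0) (Y 1) (z 0) (y 0) (y 1) (m 0)) * (dot v v - κ' ^ 2) ∧
      edgeSin V (Y 0) (Z 0) (Z 1) v (y 0) (z 0) (z 1) (n 0) =
        edgeSin V (Y 1) (Z 0) (Z 1) v (y 1) (z 0) (z 1) (n 1) ∧
      edgeSin (Z 0) V (Y 0) (Y 1) (z 0) v (y 0) (y 1) (m 0) =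
        edgeSin (Z 1) V (Y 0) (Y 1) (z 1) v (y 0) (y 1) (m 1))) := by
  set R := dot v v with hR
  have hR1 : ∀ j, κ ^ 2 + s j ^ 2 = R := fun j => by
    rw [hR, hv j]; exact (dot_self_tangentPoint (hn j)).symm
  have hR2 : ∀ k, κ' ^ 2 + t' k ^ 2 = R := fun k => by
    rw [hR, hv' k]; exact (dot_self_tangentPoint (hm k)).symm
  have hR0 : R ≠ 0 := by rw [← hR1 0]; positivity
  have hnm := fun j k => dot_normal_normal hκ (hn j) (hm k) (hv j) (hv' k)
  simp only [← hR] at hnm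
  -- oriented edge lengths
  set L : Fin 2 → ℝ := fun j => t j - s j with hL
  set L' : Fin 2 → ℝ := fun k => t' k - s' k with hL'
  have hL0 : ∀ j, L j ≠ 0 := by
    intro j h0
    apply hvy j
    rw [hv j, hy j, show t j = s j from sub_eq_zero.1 h0]
  have hL0' : ∀ k, L' k ≠ 0 := by
    intro k h0
    apply hzv k
    rw [hv' k, hz k, show t' k = s' k from sub_eq_zero.1 h0]
  have hvy' : ∀ w j, dot w (y j - v) = L j * dot w (Complex.I * n j) := by
    intro w j; rw [hy j, hv j, dot_direction_sub]
  have hzv' : ∀ w k, dot w (v - z k) = L' k * dot w (Complex.I * m k) := by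
    intro w k
    conv_lhs => rw [hz k, hv' k]
    rw [dot_direction_sub]
  have hneg : ∀ w a b : ℂ, dot w (a - b) = -dot w (b - a) := by
    intro w a b; unfold dot; simp only [Complex.sub_re, Complex.sub_im]; ring
  have hII : ∀ w : ℂ, dot w (Complex.I * w) = 0 := by intro w; unfold dot; simp; ring
  have hswap : ∀ a b : ℂ, dot a (Complex.I * b) = -dot b (Complex.I * a) := by
    intro a b; unfold dot; simp; ring
  -- the unit vectors along the four edges at `V`
  set b : Fin 2 → Fin 3 → ℝ := fun j => (L j)⁻¹ • (Y j - V).ofLp with hb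
  set c : Fin 2 → Fin 3 → ℝ := fun k => (L' k)⁻¹ • (V - Z k).ofLp with hc
  have hbY : ∀ j, (Y j - V).ofLp = L j • b j := by
    intro j; rw [hb]; simp only [smul_smul]; rw [mul_inv_cancel₀ (hL0 j), one_smul]
  have hcZ : ∀ k, (V - Z k).ofLp = L' k • c k := by
    intro k; rw [hc]; simp only [smul_smul]; rw [mul_inv_cancel₀ (hL0' k), one_smul]
  have hZc : ∀ k, (Z k - V).ofLp = (-L' k) • c k := by
    intro k; rw [← neg_sub V (Z k), WithLp.ofLp_neg, hcZ, neg_smul]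
  have hYZd : ∀ j k, (Y j - Z k).ofLp = L j • b j + L' k • c k := by
    intro j k; rw [← sub_add_sub_cancel (Y j) V (Z k), WithLp.ofLp_add, hbY, hcZ]
  have hdist : ∀ x x' : Space, dist x x' ^ 2 = (x' - x).ofLp ⬝ᵥ (x' - x).ofLp := by
    intro x x'; rw [dist_comm, dist_eq_norm, ← real_inner_self_eq_norm_sq, space_inner_eq]
  have hbb : ∀ j, b j ⬝ᵥ b j = 1 := by
    intro j
    have h1 := hVY j
    rw [hdist, hbY, hvy', dot_comm, hvy', dot_I_mul_I_mul, hn] at h1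
    simp only [smul_dotProduct, dotProduct_smul, smul_eq_mul] at h1
    apply mul_left_cancel₀ (hL0 j)
    apply mul_left_cancel₀ (hL0 j)
    exact h1
  have hcc : ∀ k, c k ⬝ᵥ c k = 1 := by
    intro k
    have h1 := hZV k
    rw [hdist, hcZ, hzv', dot_comm, hzv', dot_I_mul_I_mul, hm] at h1
    simp only [smul_dotProduct, dotProduct_smul, smul_eq_mul] at h1
    apply mul_left_cancel₀ (hL0' k)
    apply mul_left_cancel₀ (hL0' k)
    exact h1
  have hbc : ∀ j k, b j ⬝ᵥ c k = dot (n j) (m k) := by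
    intro j k
    have h1 := hYZ j k
    rw [dist_comm, hdist, hYZd] at h1
    have h2 : dot (z k - y j) (z k - y j) = L j ^ 2 + L' k ^ 2 + 2 * L j * L' k * dot (n j) (m k) := by
      have e : dot (z k - y j) (z k - y j) = dot (y j - v) (y j - v) + dot (v - z k) (v - z k)
          + 2 * dot (v - z k) (y j - v) := by
        unfold dot; simp only [Complex.sub_re, Complex.sub_im]; ring
      rw [e, hvy', dot_comm, hvy', dot_I_mul_I_mul, hn, hzv', dot_comm, hzv', dot_I_mul_I_mul, hm, hvy',
        dot_comm (v - z k), hzv', dot_I_mul_I_mul]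
      ring
    rw [h2] at h1
    simp only [add_dotProduct, dotProduct_add, smul_dotProduct, dotProduct_smul, smul_eq_mul,
      hbb, hcc, dotProduct_comm (c k) (b j)] at h1
    apply mul_left_cancel₀ (hL0 j)
    apply mul_left_cancel₀ (hL0' k)
    linear_combination h1 / 2
  -- products of the heights of the two faces at an edge
  have hK : ∀ j, (κ * t' 0 - s j * κ') / R * ((κ * t' 1 - s j * κ') / R) = (κ' ^ 2 - κ ^ 2) / R := by
    intro j
    rw [ht']
    field_simp
    linear_combination κ' ^ 2 * hR1 j - κ ^ 2 * hR2 0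
  have hK' : ∀ k, (κ * t' k - s 0 * κ') / R * ((κ * t' k - s 1 * κ') / R) =
      (κ ^ 2 - κ' ^ 2) / R := by
    intro k
    rw [hs]
    field_simp
    linear_combination -κ' ^ 2 * hR1 0 + κ ^ 2 * hR2 k
  have hΓ : ∀ j, (κ * κ' + s j * t' 0) / R * ((κ * κ' + s j * t' 1) / R) =
      (κ ^ 2 + κ' ^ 2 - R) / R := by
    intro j
    rw [ht']
    field_simp
    linear_combination (-t' 0 ^ 2) * hR1 j + (κ ^ 2 - R) * hR2 0
  have hΓ' : ∀ k, (κ * κ' + s 0 * t' k) / R * ((κ * κ' + s 1 * t' k) / R) =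
      (κ ^ 2 + κ' ^ 2 - R) / R := by
    intro k
    rw [hs]
    field_simp
    linear_combination (-t' k ^ 2) * hR1 0 + (κ ^ 2 - R) * hR2 k
  have hne : (κ' ^ 2 - κ ^ 2) / R ≠ 0 := div_ne_zero (sub_ne_zero.2 hκκ'.symm) hR0
  have hne' : (κ ^ 2 - κ' ^ 2) / R ≠ 0 := div_ne_zero (sub_ne_zero.2 hκκ') hR0
  have hcos : ∀ j, edgeCos V (Z 0) (Z 1) v (z 0) (z 1) (n j) =
      (c 0 ⬝ᵥ c 1 - (κ ^ 2 + κ' ^ 2 - R) / R) / ((κ' ^ 2 - κ ^ 2) / R) := by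
    intro j
    unfold edgeCos
    rw [space_inner_eq, hZc, hZc, hneg _ (z 0), hneg _ (z 1), hzv', hzv', hzv', hzv',
      dot_I_mul_I_mul, dot_I_mul_I_mul, (hnm j 0).1, (hnm j 1).1, (hnm j 0).2, (hnm j 1).2]
    simp only [smul_dotProduct, dotProduct_smul, smul_eq_mul]
    rw [← hK j, ← hΓ j]
    refine Eq.trans ?_ (mul_div_mul_left _ _ (mul_ne_zero (hL0' 0) (hL0' 1)))
    congr 1 <;> ring
  have hcos' : ∀ k, edgeCos (Z k) (Y 0) (Y 1) (z k) (y 0) (y 1) (m k) =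
      (b 0 ⬝ᵥ b 1 - (κ ^ 2 + κ' ^ 2 - R) / R) / ((κ ^ 2 - κ' ^ 2) / R) := by
    intro k
    unfold edgeCos
    have e₁ : ∀ j, dot (Complex.I * m k) (y j - z k) = L j * ((κ * κ' + s j * t' k) / R) + L' k := by
      intro j
      have : dot (Complex.I * m k) (y j - z k) =
          dot (Complex.I * m k) (y j - v) + dot (Complex.I * m k) (v - z k) := by
        unfold dot; simp only [Complex.sub_re, Complex.sub_im]; ring
      rw [this, hvy', hzv', dot_I_mul_I_mul, dot_I_mul_I_mul, hm, dot_comm, (hnm j k).1, mul_one]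
    have e₂ : ∀ j, dot (m k) (z k - y j) = L j * ((κ * t' k - s j * κ') / R) := by
      intro j
      have : dot (m k) (z k - y j) = -dot (m k) (y j - v) - dot (m k) (v - z k) := by
        unfold dot; simp only [Complex.sub_re, Complex.sub_im]; ring
      rw [this, hvy', hzv', hII, hswap, (hnm j k).2]
      ring
    rw [space_inner_eq, hYZd, hYZd, e₁, e₁, e₂, e₂]
    simp only [add_dotProduct, dotProduct_add, smul_dotProduct, dotProduct_smul, smul_eq_mul,
      hcc, hbc, dotProduct_comm (c k) (b _), (hnm _ _).1]
    rw [← hK' k, ← hΓ' k]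
    refine Eq.trans ?_ (mul_div_mul_left _ _ (mul_ne_zero (hL0 0) (hL0 1)))
    congr 1 <;> ring
  have hsin : ∀ j, edgeSin V (Y j) (Z 0) (Z 1) v (y j) (z 0) (z 1) (n j) =
      b j ⬝ᵥ (c 0 ⨯₃ c 1) / ((κ' ^ 2 - κ ^ 2) / R) := by
    intro j
    unfold edgeSin
    rw [space_inner_eq, ofLp_cross, hbY, hZc, hZc, hvy', hzv', hzv', dot_I_mul_I_mul, hn,
      (hnm j 0).2, (hnm j 1).2, ← hK j]
    simp only [smul_dotProduct, dotProduct_smul, smul_eq_mul, map_smul, LinearMap.smul_apply]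
    refine Eq.trans ?_ (mul_div_mul_left _ _ (mul_ne_zero (hL0 j) (mul_ne_zero (hL0' 0) (hL0' 1))))
    congr 1 <;> ring
  have hsin' : ∀ k, edgeSin (Z k) V (Y 0) (Y 1) (z k) v (y 0) (y 1) (m k) =
      c k ⬝ᵥ (b 0 ⨯₃ b 1) / ((κ ^ 2 - κ' ^ 2) / R) := by
    intro k
    unfold edgeSin
    have e₂ : ∀ j, dot (m k) (z k - y j) = L j * ((κ * t' k - s j * κ') / R) := by
      intro j
      have : dot (m k) (z k - y j) = -dot (m k) (y j - v) - dot (m k) (v - z k) := by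
        unfold dot; simp only [Complex.sub_re, Complex.sub_im]; ring
      rw [this, hvy', hzv', hII, hswap, (hnm j k).2]
      ring
    rw [space_inner_eq, ofLp_cross, hcZ, hYZd, hYZd, hzv', dot_I_mul_I_mul, hm, e₂, e₂, ← hK' k]
    refine Eq.trans ?_ (mul_div_mul_left _ _ (mul_ne_zero (hL0' k) (mul_ne_zero (hL0 0) (hL0 1))))
    congr 1
    · simp only [cross_apply, Matrix.vec3_dotProduct, Pi.add_apply, Pi.smul_apply, smul_eq_mul,
        Matrix.cons_val]
      ring
    · ring
  refine ⟨?_, by rw [hcos, hcos], by rw [hcos', hcos'], ?_⟩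
  · intro j
    have h1 : (κ * t' 0 - s j * κ') / R * ((κ * t' 1 - s j * κ') / R) ≠ 0 := by
      rw [hK]; exact hne
    rw [hzv', hzv', (hnm j 0).2, (hnm j 1).2]
    exact ⟨mul_ne_zero (hL0' 0) (left_ne_zero_of_mul h1),
      mul_ne_zero (hL0' 1) (right_ne_zero_of_mul h1)⟩
  have hmain := @isogram_dichotomy (b 0) (b 1) (c 0) (c 1) κ κ' (s 0) (t' 0) R
    (edgeCos V (Z 0) (Z 1) v (z 0) (z 1) (n 0))
    (edgeCos (Z 0) (Y 0) (Y 1) (z 0) (y 0) (y 1) (m 0)) hR0 (hR1 0) (hR2 0) hκκ' (hbb 0) (hbb 1)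
    (hcc 0) (hcc 1) (by rw [hbc, (hnm 0 0).1]) (by rw [hbc, (hnm 0 1).1, ht']; ring)
    (by rw [hbc, (hnm 1 0).1, hs]; ring) (by rw [hbc, (hnm 1 1).1, ht', hs]; ring)
    (by rw [hcos, mul_div_cancel₀ _ hne]; ring) (by rw [hcos', mul_div_cancel₀ _ hne']; ring)
  rw [hsin, hsin, hsin', hsin']
  rcases hmain with ⟨h1, h2, h3⟩ | ⟨h1, h2, h3⟩
  · exact Or.inl ⟨h1, by rw [h2, neg_div], by rw [h3, neg_div]⟩
  · exact Or.inr ⟨h1, by rw [h2], by rw [h3]⟩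

/-! ### Dihedral angles of an edge -/

/-- The sign `(-1) ^ i` attached to the index of a vertex inside its class. -/
def sgn (i : Fin 2) : ℝ := (-1) ^ (i : ℕ)

@[simp] lemma sgn_zero : sgn 0 = 1 := by simp [sgn]

@[simp] lemma sgn_one : sgn 1 = -1 := by simp [sgn]

lemma units_smul_eq (e : ℤˣ) (x : Space) : e • x = (((e : ℤ) : ℝ)) • x := by
  rcases Int.units_eq_one_or e with rfl | rfl <;> simp [Units.smul_def]

lemma units_sq (e : ℤˣ) : (((e : ℤ) : ℝ)) * ((e : ℤ) : ℝ) = 1 := by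
  rcases Int.units_eq_one_or e with rfl | rfl <;> simp

/-- The dihedral angle at the edge `AB` in terms of inner products. Here `g₀, h₀` and `g₁, h₁` are
the coordinates of `Z₀` and `Z₁` in the planes of their faces, along and across the edge, and `L`
is the signed length of the edge. -/
lemma cos_sin_of_towards_eq {A B Z₀ Z₁ : Space} {L g₀ g₁ h₀ h₁ α : ℝ} {e : ℤˣ} (hL : L ≠ 0)
    (hh₀ : h₀ ≠ 0) (hh₁ : h₁ ≠ 0) (huu : ⟪B - A, B - A⟫ = L ^ 2)
    (hu₀ : ⟪B - A, Z₀ - A⟫ = L * g₀) (hu₁ : ⟪B - A, Z₁ - A⟫ = L * g₁)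
    (h₀₀ : ⟪Z₀ - A, Z₀ - A⟫ = g₀ ^ 2 + h₀ ^ 2) (h₁₁ : ⟪Z₁ - A, Z₁ - A⟫ = g₁ ^ 2 + h₁ ^ 2)
    (h : towards A B Z₁ = Real.cos α • towards A B Z₀ +
      Real.sin α • e • NormedSpace.normalize (cross (B - A) (Z₀ - A))) :
    ∃ δ : ℝ, δ * δ = 1 ∧
      Real.cos α = δ * ((⟪Z₀ - A, Z₁ - A⟫ - g₀ * g₁) / (h₀ * h₁)) ∧
      Real.sin α = δ * (((e : ℤ) : ℝ) * (L / |L|)) *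
        (⟪B - A, cross (Z₀ - A) (Z₁ - A)⟫ / (L * (h₀ * h₁))) := by
  have he := units_sq e
  rw [units_smul_eq] at h
  set ε : ℝ := ((e : ℤ) : ℝ) with hε
  set u := B - A with hu
  set z₀ := Z₀ - A with hz₀
  set z₁ := Z₁ - A with hz₁
  set N := cross u z₀ with hN
  have hnu : ‖u‖ ^ 2 = L ^ 2 := by rw [← real_inner_self_eq_norm_sq, huu]
  have hcoef : ∀ g : ℝ, L * g / L ^ 2 = g / L := by intro g; field_simp
  have ht : ∀ (Z : Space) (g k : ℝ), ⟪u, Z - A⟫ = L * g → ⟪Z - A, Z - A⟫ = g ^ 2 + k ^ 2 →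
      towards A B Z = |k|⁻¹ • ((Z - A) - (g / L) • u) := by
    intro Z g k h1 h2
    have h3 : ‖(Z - A) - (g / L) • u‖ = |k| := by
      generalize Z - A = z at h1 h2
      have h4 : ⟪z, u⟫ = L * g := by rw [real_inner_comm, h1]
      rw [← sq_eq_sq₀ (norm_nonneg _) (abs_nonneg _), sq_abs, ← real_inner_self_eq_norm_sq]
      simp only [inner_sub_left, inner_sub_right, real_inner_smul_left, real_inner_smul_right,
        h1, h2, h4, huu]
      field_simp
      ring
    unfold towards
    rw [← hu, h1, hnu, hcoef, NormedSpace.normalize, h3]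
  rw [ht Z₀ g₀ h₀ hu₀ h₀₀, ht Z₁ g₁ h₁ hu₁ h₁₁, ← hz₀, ← hz₁] at h
  have hNu : ⟪N, u⟫ = 0 := by
    rw [space_inner_eq, hN, ofLp_cross, dotProduct_comm, dot_self_cross]
  have hNz : ⟪N, z₀⟫ = 0 := by
    rw [space_inner_eq, hN, ofLp_cross, dotProduct_comm, dot_cross_self]
  have hNN : ⟪N, N⟫ = L ^ 2 * h₀ ^ 2 := by
    rw [space_inner_eq, hN, ofLp_cross, cross_dot_cross, ← space_inner_eq, ← space_inner_eq,
      ← space_inner_eq, ← space_inner_eq, huu, h₀₀, hu₀, real_inner_comm, hu₀]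
    ring
  have hNn : ‖N‖ = |L| * |h₀| := by
    rw [← sq_eq_sq₀ (norm_nonneg _) (by positivity), ← real_inner_self_eq_norm_sq, hNN, mul_pow,
      sq_abs, sq_abs]
  have hNz₁ : ⟪N, z₁⟫ = ⟪u, cross z₀ z₁⟫ := by
    rw [space_inner_eq, space_inner_eq, hN, ofLp_cross, ofLp_cross, dotProduct_comm,
      triple_product_permutation]
  rw [NormedSpace.normalize, hNn] at h
  have hz₀u : ⟪z₀, u⟫ = L * g₀ := by rw [real_inner_comm, hu₀]
  have huN : ⟪u, N⟫ = 0 := by rw [real_inner_comm, hNu]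
  have hzN : ⟪z₀, N⟫ = 0 := by rw [real_inner_comm, hNz]
  have c₁ := congrArg (fun x => ⟪z₀ - (g₀ / L) • u, x⟫) h
  have c₂ := congrArg (fun x => ⟪N, x⟫) h
  simp only [inner_add_right, inner_sub_left, inner_sub_right, real_inner_smul_left,
    real_inner_smul_right, huu, hu₀, hu₁, h₀₀, huN, hzN,
    hNu, hNz, hNN, hNz₁, hz₀u] at c₁ c₂
  have a₀ : |h₀| ≠ 0 := abs_ne_zero.2 hh₀
  have a₁ : |h₁| ≠ 0 := abs_ne_zero.2 hh₁
  have aL : |L| ≠ 0 := abs_ne_zero.2 hL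
  have s₀ : |h₀| ^ 2 = h₀ ^ 2 := sq_abs _
  have s₁ : |h₁| ^ 2 = h₁ ^ 2 := sq_abs _
  have sL : |L| ^ 2 = L ^ 2 := sq_abs _
  refine ⟨h₀ * h₁ / (|h₀| * |h₁|), ?_, ?_, ?_⟩
  · field_simp
    rw [s₀, s₁]
  · have e₁ : |h₀| * (⟪z₀, z₁⟫ - g₀ * g₁) = Real.cos α * |h₀| ^ 2 * |h₁| := by
      field_simp at c₁
      rw [s₀]
      apply mul_left_cancel₀ (mul_ne_zero hL aL)
      linear_combination c₁
    field_simp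
    apply mul_left_cancel₀ a₀
    linear_combination -e₁
  · have e₂ : ⟪u, cross z₀ z₁⟫ * |L| * |h₀| =
        Real.sin α * ε * (|L| ^ 2 * |h₀| ^ 2) * |h₁| := by
      field_simp at c₂
      rw [s₀, sL]
      apply mul_left_cancel₀ hL
      linear_combination c₂
    have e₃ : ⟪u, cross z₀ z₁⟫ = Real.sin α * ε * |L| * |h₀| * |h₁| := by
      apply mul_right_cancel₀ (mul_ne_zero aL a₀)
      linear_combination e₂
    rw [e₃]
    field_simp
    linear_combination -Real.sin α * he

/-- A `ℚ`-linear function that vanishes at `π` only depends on the sine and cosine of an angle, up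
to the signs that come from adding `π` and from reversing the angle. -/
lemma map_angle_eq (f : ℝ →ₗ[ℚ] ℝ) (hf : f Real.pi = 0) {α β η θ : ℝ} (hη : η * η = 1)
    (hθ : θ * θ = 1) (hc : Real.cos α = η * Real.cos β) (hs : Real.sin α = η * θ * Real.sin β) :
    f α = θ * f β := by
  have h2 : ∀ x y : ℝ, Real.cos x = Real.cos y → Real.sin x = Real.sin y → f x = f y := by
    intro x y h1 h2
    have h3 := Real.Angle.cos_sin_inj h1 h2
    obtain ⟨k, hk⟩ := Real.Angle.angle_eq_iff_two_pi_dvd_sub.1 h3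
    have h4 : x = y + (2 * k : ℚ) • Real.pi := by
      rw [Rat.smul_def]; push_cast; linarith
    rw [h4, map_add, map_smul, hf, smul_zero, add_zero]
  rcases mul_self_eq_one_iff.1 hη with rfl | rfl <;> rcases mul_self_eq_one_iff.1 hθ with rfl | rfl
  · rw [one_mul]; exact h2 _ _ (by linarith) (by linarith)
  · rw [h2 α (-β) (by rw [Real.cos_neg]; linarith) (by rw [Real.sin_neg]; linarith), map_neg]; ring
  · rw [h2 α (β + Real.pi) (by rw [Real.cos_add_pi]; linarith)
      (by rw [Real.sin_add_pi]; linarith), map_add, hf]; ring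
  · rw [h2 α (-β + Real.pi) (by rw [Real.cos_add_pi, Real.cos_neg]; linarith)
      (by rw [Real.sin_add_pi, Real.sin_neg]; linarith), map_add, hf, map_neg]; ring

/-- Passage from the dihedral angles measured in the flat position to arbitrary dihedral angles. -/
lemma sum_mul_map_angle_eq_zero (f : ℝ →ₗ[ℚ] ℝ) (hf : f Real.pi = 0) (ε : ℤˣ) {C : ℝ}
    {S L α : Fin 2 → Fin 2 → ℝ} (hL : ∀ i j, L i j ≠ 0)
    (hα : ∀ i j, ∃ δ : ℝ, δ * δ = 1 ∧ Real.cos (α i j) = δ * C ∧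
      Real.sin (α i j) = δ * (((ε * (-1) ^ ((i : ℕ) + (j : ℕ)) : ℤˣ) : ℤ) * (L i j / |L i j|)) *
        S i j)
    (hsum : C ^ 2 ≠ 1 → ∑ i, ∑ j, sgn i * sgn j * (S i j * L i j) = 0) :
    ∑ i, ∑ j, |L i j| * f (α i j) = 0 := by
  set u : Fin 2 → Fin 2 → ℝ :=
    fun i j => ((ε * (-1) ^ ((i : ℕ) + (j : ℕ)) : ℤˣ) : ℤ) * (L i j / |L i j|) with hu
  have hu1 : ∀ i j, u i j * u i j = 1 := by
    intro i j
    have h1 : L i j / |L i j| * (L i j / |L i j|) = 1 := by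
      have := abs_ne_zero.2 (hL i j)
      field_simp
      rw [sq_abs]
    rw [hu]
    simp only
    rw [mul_mul_mul_comm, units_sq, h1, one_mul]
  have huL : ∀ i j, |L i j| * u i j = ((ε : ℤ) : ℝ) * (sgn i * sgn j * L i j) := by
    intro i j
    have h1 : |L i j| * (L i j / |L i j|) = L i j := mul_div_cancel₀ _ (abs_ne_zero.2 (hL i j))
    rw [hu]
    simp only
    rw [mul_left_comm, h1]
    unfold sgn
    push_cast
    rw [pow_add]
    ring
  choose δ hδ hcos hsin using hα
  have hone : ∀ i j, C ^ 2 + S i j ^ 2 = 1 := by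
    intro i j
    have h1 := Real.cos_sq_add_sin_sq (α i j)
    rw [hcos, hsin] at h1
    have h2 : (δ i j * C) ^ 2 + (δ i j * u i j * S i j) ^ 2 =
        (δ i j * δ i j) * C ^ 2 + (δ i j * δ i j) * (u i j * u i j) * S i j ^ 2 := by ring
    rw [h2, hδ, hu1] at h1
    linarith
  by_cases hC : C ^ 2 = 1
  · have hS : ∀ i j, S i j = 0 := fun i j => by
      have := hone i j
      exact pow_eq_zero_iff two_ne_zero |>.1 (by linarith)
    have hf0 : ∀ i j, f (α i j) = 0 := by
      intro i j
      have h1 := map_angle_eq f hf (α := α i j) (β := 0) (η := δ i j * C) (θ := 1)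
        (by rw [mul_mul_mul_comm, hδ, ← sq, hC, one_mul]) (one_mul 1)
        (by rw [hcos, Real.cos_zero, mul_one]) (by rw [hsin, hS, Real.sin_zero]; ring)
      rw [h1, map_zero, mul_zero]
    simp [hf0]
  · have hS : S 0 0 ≠ 0 := by
      intro h0
      have := hone 0 0
      rw [h0] at this
      exact hC (by linarith)
    have hmap : ∀ i j, f (α i j) = u i j * u 0 0 * (S i j / S 0 0) * f (α 0 0) := by
      intro i j
      have hSS : S i j / S 0 0 * (S i j / S 0 0) = 1 := by
        have h1 := hone i j
        have h2 := hone 0 0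
        field_simp
        linarith
      refine map_angle_eq f hf (η := δ i j * δ 0 0) ?_ ?_ ?_ ?_
      · rw [mul_mul_mul_comm, hδ, hδ, one_mul]
      · rw [mul_mul_mul_comm, mul_mul_mul_comm (u i j), hu1, hu1, hSS]; ring
      · rw [hcos, hcos]; linear_combination (-δ i j * C) * hδ 0 0
      · have e : S i j / S 0 0 * S 0 0 = S i j := div_mul_cancel₀ _ hS
        rw [hsin, hsin]
        change δ i j * u i j * S i j = δ i j * δ 0 0 * (u i j * u 0 0 * (S i j / S 0 0)) *
          (δ 0 0 * u 0 0 * S 0 0)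
        rw [show δ i j * δ 0 0 * (u i j * u 0 0 * (S i j / S 0 0)) * (δ 0 0 * u 0 0 * S 0 0) =
          δ i j * u i j * (δ 0 0 * δ 0 0) * (u 0 0 * u 0 0) * (S i j / S 0 0 * S 0 0) by ring,
          hδ, hu1, e]
        ring
    have hterm : ∀ i j, |L i j| * f (α i j) =
        ((ε : ℤ) : ℝ) * u 0 0 * f (α 0 0) / S 0 0 * (sgn i * sgn j * (S i j * L i j)) := by
      intro i j
      rw [hmap]
      linear_combination (u 0 0 * (S i j / S 0 0) * f (α 0 0)) * huL i j
    simp only [hterm, ← Finset.mul_sum]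
    rw [hsum hC, mul_zero]

/-! ### The equators -/

/-- `edgeCos` for the edge from `Q r i` to `Q (r + 1) j` of an octahedron with flat position `X`. -/
def frameCos (X : Fin 3 → Fin 2 → ℂ) (n : Fin 3 → Fin 2 → Fin 2 → ℂ) (Q : Placement Space)
    (r : Fin 3) (i j : Fin 2) : ℝ :=
  edgeCos (Q r i) (Q (r + 2) 0) (Q (r + 2) 1) (X r i) (X (r + 2) 0) (X (r + 2) 1) (n r i j)

/-- `edgeSin` for the edge from `Q r i` to `Q (r + 1) j` of an octahedron with flat position `X`. -/
def frameSin (X : Fin 3 → Fin 2 → ℂ) (n : Fin 3 → Fin 2 → Fin 2 → ℂ) (Q : Placement Space)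
    (r : Fin 3) (i j : Fin 2) : ℝ :=
  edgeSin (Q r i) (Q (r + 1) j) (Q (r + 2) 0) (Q (r + 2) 1) (X r i) (X (r + 1) j)
    (X (r + 2) 0) (X (r + 2) 1) (n r i j)

/-- The two vertices of a class have links in the same family, and if this is the second family,
they are equidistant from the centre. Here `q`, `q'` are the squared radii of the two circles and
`R₀`, `R₁` the squared distances of the vertices from the centre. -/
lemma class_dichotomy {C C' q q' R₀ R₁ : ℝ} {G₀ G₁ B₀ B₁ : Prop} (hC : C ^ 2 ≠ 1 ∨ C' ^ 2 ≠ 1)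
    (hq : q ≠ q') (hR₀ : R₀ ≠ 0) (hR₁ : R₁ ≠ 0)
    (h₀ : ((1 - C) * (1 + C') * q = (1 + C) * (1 - C') * q' ∧ G₀) ∨
      ((1 - C) * (1 + C') * (R₀ - q) = (1 + C) * (1 - C') * (R₀ - q') ∧ B₀))
    (h₁ : ((1 - C) * (1 + C') * q = (1 + C) * (1 - C') * q' ∧ G₁) ∨
      ((1 - C) * (1 + C') * (R₁ - q) = (1 + C) * (1 - C') * (R₁ - q') ∧ B₁)) :
    ((1 - C) * (1 + C') * q = (1 + C) * (1 - C') * q' ∧ G₀ ∧ G₁) ∨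
      ((1 - C) * (1 + C') * q ≠ (1 + C) * (1 - C') * q' ∧ R₀ = R₁ ∧ B₀ ∧ B₁) := by
  have hzero : (1 - C) * (1 + C') = (1 + C) * (1 - C') →
      ((1 - C) * (1 + C') = 0 → False) := by
    intro e h
    have e' := e.symm.trans h
    have h1 : C = C' := by linarith
    have h2 : C ^ 2 = 1 := by rw [← h1] at h; linarith
    rcases hC with hC | hC
    · exact hC h2
    · exact hC (h1 ▸ h2)
  by_cases hrel : (1 - C) * (1 + C') * q = (1 + C) * (1 - C') * q'
  · have hno : ∀ R : ℝ, R ≠ 0 →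
        (1 - C) * (1 + C') * (R - q) ≠ (1 + C) * (1 - C') * (R - q') := by
      intro R hR h
      have e : (1 - C) * (1 + C') = (1 + C) * (1 - C') := by
        apply mul_right_cancel₀ hR; linear_combination h + hrel
      refine hzero e ?_
      rw [← e] at hrel
      by_contra h0
      exact hq (mul_left_cancel₀ h0 hrel)
    left
    exact ⟨hrel, (h₀.resolve_right fun h => hno _ hR₀ h.1).2,
      (h₁.resolve_right fun h => hno _ hR₁ h.1).2⟩
  · right
    obtain ⟨b₀, hB₀⟩ := h₀.resolve_left fun h => hrel h.1
    obtain ⟨b₁, hB₁⟩ := h₁.resolve_left fun h => hrel h.1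
    refine ⟨hrel, ?_, hB₀, hB₁⟩
    by_contra hR
    have e : (1 - C) * (1 + C') = (1 + C) * (1 - C') := by
      apply mul_right_cancel₀ (sub_ne_zero.2 hR); linear_combination b₀ - b₁
    refine hzero e ?_
    rw [← e] at b₀
    by_contra h0
    have := mul_left_cancel₀ h0 b₀
    exact hq (by linarith)

variable {X : Fin 3 → Fin 2 → ℂ} {κ : Fin 3 → ℝ} {n : Fin 3 → Fin 2 → Fin 2 → ℂ}
  {s t : Fin 3 → Fin 2 → Fin 2 → ℝ} {Q : Placement Space}

/-- `vertex_dichotomy` for the vertex `i` of class `r` of an octahedron with flat position `X`. -/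
lemma TangentFrame.vertex (h : TangentFrame X κ n s t)
    (hQ : ∀ r i j, dist (Q r i) (Q (r + 1) j) ^ 2 =
      dot (X (r + 1) j - X r i) (X (r + 1) j - X r i)) (r : Fin 3) (i : Fin 2) :
    (∀ j, dot (n r i j) (X r i - X (r + 2) 0) ≠ 0 ∧ dot (n r i j) (X r i - X (r + 2) 1) ≠ 0) ∧
    frameCos X n Q r i 1 = frameCos X n Q r i 0 ∧
    frameCos X n Q (r + 2) 1 i = frameCos X n Q (r + 2) 0 i ∧
    (((1 - frameCos X n Q r i 0) * (1 + frameCos X n Q (r + 2) 0 i) * κ r ^ 2 =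
        (1 + frameCos X n Q r i 0) * (1 - frameCos X n Q (r + 2) 0 i) * κ (r + 2) ^ 2 ∧
      frameSin X n Q r i 0 = -frameSin X n Q r i 1 ∧
      frameSin X n Q (r + 2) 0 i = -frameSin X n Q (r + 2) 1 i) ∨
     ((1 - frameCos X n Q r i 0) * (1 + frameCos X n Q (r + 2) 0 i) *
          (dot (X r i) (X r i) - κ r ^ 2) =
        (1 + frameCos X n Q r i 0) * (1 - frameCos X n Q (r + 2) 0 i) *
          (dot (X r i) (X r i) - κ (r + 2) ^ 2) ∧
      frameSin X n Q r i 0 = frameSin X n Q r i 1 ∧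
      frameSin X n Q (r + 2) 0 i = frameSin X n Q (r + 2) 1 i)) := by
  have e₁ : r + 2 + 1 = r := by fin_cases r <;> rfl
  have e₂ : r + 2 + 2 = r + 1 := by fin_cases r <;> rfl
  have e₃ : r + 1 + 1 = r + 2 := by fin_cases r <;> rfl
  simp only [frameCos, frameSin, e₁, e₂]
  have hq := h.quad r
  have hq' := h.quad (r + 2)
  have hne := h.sq_ne (r + 2)
  have hz := hQ (r + 2)
  have hy := hQ (r + 1)
  have ht := h.t_one (r + 2) i
  have hzv := h.ne (r + 2)
  rw [e₁] at hq' hne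
  simp only [e₁] at hz hzv
  simp only [e₃] at hy
  exact vertex_dichotomy (V := Q r i) (Y := Q (r + 1)) (Z := Q (r + 2)) (v := X r i)
    (y := X (r + 1)) (z := X (r + 2)) (n := n r i) (m := fun k => n (r + 2) k i) (s := s r i)
    (t := t r i) (s' := fun k => s (r + 2) k i) (t' := fun k => t (r + 2) k i)
    hq.pos hne.symm (hq.unit i) (fun k => hq'.unit k i) (hq.left i) (hq.right i)
    (fun k => hq'.left k i) (fun k => hq'.right k i) (h.s_one r i) ht (h.ne r i)
    (fun k => hzv k i) (hQ r i) (fun k => hz k i) hy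

/-- The four cosines on an equator coincide: this holds for the two edges at each vertex of the
equator. -/
lemma TangentFrame.frameCos_eq (h : TangentFrame X κ n s t)
    (hQ : ∀ r i j, dist (Q r i) (Q (r + 1) j) ^ 2 =
      dot (X (r + 1) j - X r i) (X (r + 1) j - X r i)) (r : Fin 3) (i j : Fin 2) :
    frameCos X n Q r i j = frameCos X n Q r 0 0 := by
  have e : r + 1 + 2 = r := by fin_cases r <;> rfl
  have h1 := fun i => (h.vertex hQ r i).2.1
  have h2 := fun j => (h.vertex hQ (r + 1) j).2.2.1
  simp only [e] at h2
  have h1' : frameCos X n Q r i j = frameCos X n Q r i 0 := by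
    fin_cases j
    · rfl
    · exact h1 i
  rw [h1']
  fin_cases i
  · rfl
  · exact h2 0

/-- The hypothesis excludes the case in which the octahedron is folded flat along both equators
through the vertices of class `r`; then their links may belong to both families. -/
lemma TangentFrame.class_dichotomy (h : TangentFrame X κ n s t)
    (hQ : ∀ r i j, dist (Q r i) (Q (r + 1) j) ^ 2 =
      dot (X (r + 1) j - X r i) (X (r + 1) j - X r i)) (r : Fin 3)
    (hC : frameCos X n Q r 0 0 ^ 2 ≠ 1 ∨ frameCos X n Q (r + 2) 0 0 ^ 2 ≠ 1) :
    ((1 - frameCos X n Q r 0 0) * (1 + frameCos X n Q (r + 2) 0 0) * κ r ^ 2 =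
        (1 + frameCos X n Q r 0 0) * (1 - frameCos X n Q (r + 2) 0 0) * κ (r + 2) ^ 2 ∧
      ∀ i, frameSin X n Q r i 0 = -frameSin X n Q r i 1 ∧
        frameSin X n Q (r + 2) 0 i = -frameSin X n Q (r + 2) 1 i) ∨
    ((1 - frameCos X n Q r 0 0) * (1 + frameCos X n Q (r + 2) 0 0) * κ r ^ 2 ≠
        (1 + frameCos X n Q r 0 0) * (1 - frameCos X n Q (r + 2) 0 0) * κ (r + 2) ^ 2 ∧
      dot (X r 0) (X r 0) = dot (X r 1) (X r 1) ∧
      ∀ i, frameSin X n Q r i 0 = frameSin X n Q r i 1 ∧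
        frameSin X n Q (r + 2) 0 i = frameSin X n Q (r + 2) 1 i) := by
  have hR : ∀ i, dot (X r i) (X r i) ≠ 0 := by
    intro i
    have := (h.quad r).pos
    rw [(h.quad r).dot_left_self i 0]
    positivity
  have e₁ : r + 2 + 1 = r := by fin_cases r <;> rfl
  have hne := h.sq_ne (r + 2)
  rw [e₁] at hne
  have h0 := (h.vertex hQ r 0).2.2.2
  have h1 := (h.vertex hQ r 1).2.2.2
  rw [h.frameCos_eq hQ r 1 0, h.frameCos_eq hQ (r + 2) 0 1] at h1
  rcases Bricard.class_dichotomy hC hne.symm (hR 0) (hR 1) h0 h1 with ⟨a, b₀, b₁⟩ | ⟨a, b, c₀, c₁⟩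
  · refine Or.inl ⟨a, fun i => ?_⟩
    fin_cases i
    · exact b₀
    · exact b₁
  · refine Or.inr ⟨a, b, fun i => ?_⟩
    fin_cases i
    · exact c₀
    · exact c₁

/-- If the half-angle tangents are related by the ratio of the radii at two of the three classes of
vertices, then also at the third class. Here `C₀`, `C₁`, `C₂` are the cosines on the equators. -/
lemma half_angle_relation_trans {C₀ C₁ C₂ q₀ q₁ q₂ : ℝ} (hC : C₁ ^ 2 ≠ 1) (hq : q₁ ≠ 0)
    (h₁ : (1 - C₁) * (1 + C₀) * q₁ = (1 + C₁) * (1 - C₀) * q₀)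
    (h₂ : (1 - C₂) * (1 + C₁) * q₂ = (1 + C₂) * (1 - C₁) * q₁) :
    (1 - C₂) * (1 + C₀) * q₂ = (1 + C₂) * (1 - C₀) * q₀ := by
  have hm : (1 - C₁) * (1 + C₁) * q₁ ≠ 0 :=
    mul_ne_zero (fun h => hC (by linarith)) hq
  apply mul_left_cancel₀ hm
  linear_combination (1 - C₂) * (1 + C₁) * q₂ * h₁ + (1 + C₁) * (1 - C₀) * q₀ * h₂

/-- Unfolded dihedral angles propagate along the relation between half-angle tangents. -/
lemma sq_ne_one_of_half_angle_relation {C C' q q' : ℝ} (hq : q ≠ 0) (hC : C ^ 2 ≠ 1)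
    (hq' : q' ≠ 0) (h : (1 - C) * (1 + C') * q = (1 + C) * (1 - C') * q') : C' ^ 2 ≠ 1 := by
  intro h1
  have h2 : C' = 1 ∨ C' = -1 := by
    rcases sq_eq_sq_iff_eq_or_eq_neg.1 (h1.trans (one_pow 2).symm) with h | h
    · exact Or.inl h
    · exact Or.inr h
  rcases h2 with rfl | rfl
  · have : (1 - C) * q = 0 := by linarith
    have h3 := (mul_eq_zero.1 this).resolve_right hq
    exact hC (by rw [show C = 1 by linarith]; norm_num)
  · have : (1 + C) * q' = 0 := by linarith
    have h3 := (mul_eq_zero.1 this).resolve_right hq'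
    exact hC (by rw [show C = -1 by linarith]; norm_num)

/-- The signed lengths of the edges of an equator, weighted with the sines of its dihedral angles,
cancel. If opposite sines differ in sign at both classes of vertices of the equator, the offsets
cancel in pairs; otherwise the equality of distances from the centre gives the missing relation. -/
lemma TangentFrame.sum_frameSin (h : TangentFrame X κ n s t)
    (hQ : ∀ r i j, dist (Q r i) (Q (r + 1) j) ^ 2 =
      dot (X (r + 1) j - X r i) (X (r + 1) j - X r i)) (r : Fin 3)
    (hC : frameCos X n Q r 0 0 ^ 2 ≠ 1) :
    ∑ i, ∑ j, sgn i * sgn j * (frameSin X n Q r i j * (t r i j - s r i j)) = 0 := by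
  have hκ : ∀ r, κ r ^ 2 ≠ 0 := fun r => pow_ne_zero 2 (h.quad r).pos.ne'
  have c₀ := h.class_dichotomy hQ 0
  have c₁ := h.class_dichotomy hQ 1
  have c₂ := h.class_dichotomy hQ 2
  rw [show (0 : Fin 3) + 2 = 2 from rfl] at c₀
  rw [show (1 : Fin 3) + 2 = 0 from rfl] at c₁
  rw [show (2 : Fin 3) + 2 = 1 from rfl] at c₂
  -- the vertices of the middle class are not equidistant from the centre
  have g₁ := fun hC => (c₁ hC).resolve_right fun hb => h.dot_one_ne hb.2.1
  have expand : ∀ r, ∑ i, ∑ j, sgn i * sgn j * (frameSin X n Q r i j * (t r i j - s r i j)) =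
      frameSin X n Q r 0 0 * (t r 0 0 - s r 0 0) - frameSin X n Q r 0 1 * (t r 0 1 + s r 0 0) +
        frameSin X n Q r 1 0 * (t r 0 0 + s r 1 0) - frameSin X n Q r 1 1 * (t r 0 1 - s r 1 0) := by
    intro r
    simp only [Fin.sum_univ_two, sgn_zero, sgn_one, h.s_one, h.t_one]
    ring
  rw [expand]
  have k₀ : frameCos X n Q 0 0 0 ^ 2 ≠ 1 → frameSin X n Q 0 0 0 * (t 0 0 0 - s 0 0 0) -
      frameSin X n Q 0 0 1 * (t 0 0 1 + s 0 0 0) + frameSin X n Q 0 1 0 * (t 0 0 0 + s 0 1 0) -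
        frameSin X n Q 0 1 1 * (t 0 0 1 - s 0 1 0) = 0 := by
    intro hC
    obtain ⟨-, g⟩ := g₁ (Or.inr hC)
    have a₀ := (g 0).2
    have a₁ := (g 1).2
    rcases c₀ (Or.inl hC) with ⟨-, b⟩ | ⟨-, hR, b⟩
    · have b₀ := (b 0).1
      have b₁ := (b 1).1
      linear_combination (t 0 0 0 + s 0 1 0) * a₀ - (t 0 0 1 - s 0 1 0) * a₁ -
        (s 0 0 0 + s 0 1 0) * b₀
    · have b₀ := (b 0).1
      have b₁ := (b 1).1
      linear_combination (t 0 0 0 + s 0 1 0) * a₀ - (t 0 0 1 - s 0 1 0) * a₁ +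
        (s 0 0 0 + s 0 1 0) * b₀ - 2 * frameSin X n Q 0 0 0 * h.s_zero_add hR
  have k₁ : frameCos X n Q 1 0 0 ^ 2 ≠ 1 → frameSin X n Q 1 0 0 * (t 1 0 0 - s 1 0 0) -
      frameSin X n Q 1 0 1 * (t 1 0 1 + s 1 0 0) + frameSin X n Q 1 1 0 * (t 1 0 0 + s 1 1 0) -
        frameSin X n Q 1 1 1 * (t 1 0 1 - s 1 1 0) = 0 := by
    intro hC
    obtain ⟨-, g⟩ := g₁ (Or.inl hC)
    have a₀ := (g 0).1
    have a₁ := (g 1).1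
    rcases c₂ (Or.inr hC) with ⟨-, b⟩ | ⟨-, hR, b⟩
    · have b₀ := (b 0).2
      have b₁ := (b 1).2
      linear_combination t 1 0 0 * b₀ - t 1 0 1 * b₁ - s 1 0 0 * a₀ + s 1 1 0 * a₁
    · have b₀ := (b 0).2
      have b₁ := (b 1).2
      linear_combination -t 1 0 0 * b₀ + t 1 0 1 * b₁ - 2 * t 1 0 1 * a₀ - s 1 0 0 * a₀ +
        s 1 1 0 * a₁ + 2 * frameSin X n Q 1 0 0 * h.t_one_add hR
  have k₂ : frameCos X n Q 2 0 0 ^ 2 ≠ 1 → frameSin X n Q 2 0 0 * (t 2 0 0 - s 2 0 0) -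
      frameSin X n Q 2 0 1 * (t 2 0 1 + s 2 0 0) + frameSin X n Q 2 1 0 * (t 2 0 0 + s 2 1 0) -
        frameSin X n Q 2 1 1 * (t 2 0 1 - s 2 1 0) = 0 := by
    intro hC
    rcases c₂ (Or.inl hC) with ⟨r₂, a⟩ | ⟨r₂, hR₂, a⟩ <;>
      rcases c₀ (Or.inr hC) with ⟨r₀, b⟩ | ⟨r₀, hR₀, b⟩ <;>
      have a₀ := (a 0).1 <;> have a₁ := (a 1).1 <;> have b₀ := (b 0).2 <;> have b₁ := (b 1).2
    · linear_combination t 2 0 0 * b₀ - t 2 0 1 * b₁ - s 2 0 0 * a₀ + s 2 1 0 * a₁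
    -- if the links of one of the two classes are in the first family, then the half-angle tangents
    -- of all equators are related by the radii, and the other class is in the first family too
    · have hC₁ := sq_ne_one_of_half_angle_relation (hκ 2) hC (hκ 1) r₂
      have r₁ := (g₁ (Or.inl hC₁)).1
      have := half_angle_relation_trans hC₁ (hκ 1) r₁ r₂
      exact absurd (by linear_combination -this) r₀
    · have hC₀ := sq_ne_one_of_half_angle_relation (C := frameCos X n Q 2 0 0)
        (C' := frameCos X n Q 0 0 0) (hκ 2) hC (hκ 0) (by linear_combination -r₀)
      have r₁ := (g₁ (Or.inr hC₀)).1
      have := half_angle_relation_trans hC₀ (hκ 0) r₀ r₁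
      exact absurd (by linear_combination -this) r₂
    · linear_combination -t 2 0 0 * b₀ + t 2 0 1 * b₁ + 2 * t 2 0 1 * a₀ + s 2 0 0 * a₀ -
        s 2 1 0 * (2 * b₀ + a₁) + 2 * frameSin X n Q 2 0 0 * h.t_two_eq hR₀ -
        2 * frameSin X n Q 2 0 0 * h.s_two_eq hR₂
  fin_cases r
  · exact k₀ hC
  · exact k₁ hC
  · exact k₂ hC

lemma TangentFrame.edge_eq (h : TangentFrame X κ n s t) (r : Fin 3) (i j : Fin 2) (w : ℂ) :
    dot w (X (r + 1) j - X r i) = (t r i j - s r i j) * dot w (Complex.I * n r i j) := by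
  rw [(h.quad r).right i j, (h.quad r).left i j, dot_direction_sub]

lemma TangentFrame.edge_direction (h : TangentFrame X κ n s t) (r : Fin 3) (i j : Fin 2) :
    dot (Complex.I * n r i j) (X (r + 1) j - X r i) = t r i j - s r i j := by
  rw [h.edge_eq, dot_I_mul_I_mul, (h.quad r).unit, mul_one]

lemma TangentFrame.edge_sq (h : TangentFrame X κ n s t) (r : Fin 3) (i j : Fin 2) :
    dot (X (r + 1) j - X r i) (X (r + 1) j - X r i) = (t r i j - s r i j) ^ 2 := by
  rw [h.edge_eq, dot_comm, h.edge_direction, sq]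

lemma TangentFrame.edge_ne_zero (h : TangentFrame X κ n s t) (r : Fin 3) (i j : Fin 2) :
    t r i j - s r i j ≠ 0 := by
  intro h0
  apply h.ne r i j
  rw [(h.quad r).right i j, (h.quad r).left i j, sub_eq_zero.1 h0]

/-- Up to a sign common to both, the cosine and the sine of a dihedral angle agree with those
measured in the flat position. -/
lemma TangentFrame.cos_sin_of_isDihedralAngle (h : TangentFrame X κ n s t)
    (hQ : ∀ r i j, dist (Q r i) (Q (r + 1) j) ^ 2 =
      dot (X (r + 1) j - X r i) (X (r + 1) j - X r i)) {ε : ℤˣ} {r : Fin 3} {i j : Fin 2} {α : ℝ}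
    (hα : IsDihedralAngle ε Q r i j α) :
    ∃ δ : ℝ, δ * δ = 1 ∧ Real.cos α = δ * frameCos X n Q r i j ∧
      Real.sin α = δ * (((ε * (-1) ^ ((i : ℕ) + (j : ℕ)) : ℤˣ) : ℤ) *
        ((t r i j - s r i j) / |t r i j - s r i j|)) * frameSin X n Q r i j := by
  have e₁ : r + 1 + 1 = r + 2 := by fin_cases r <;> rfl
  have e₂ : r + 2 + 1 = r := by fin_cases r <;> rfl
  have hn := (h.quad r).unit i j
  have hdist : ∀ x y : Space, dist x y ^ 2 = ⟪y - x, y - x⟫ := by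
    intro x y; rw [dist_comm, dist_eq_norm, real_inner_self_eq_norm_sq]
  have hI := h.edge_direction r i j
  have hL := h.edge_eq r i j
  have huu : ⟪Q (r + 1) j - Q r i, Q (r + 1) j - Q r i⟫ = (t r i j - s r i j) ^ 2 := by
    rw [← hdist, hQ, h.edge_sq]
  -- the coordinates of the third vertex of a face along and across the edge
  have hzz : ∀ k, ⟪Q (r + 2) k - Q r i, Q (r + 2) k - Q r i⟫ =
      dot (X (r + 2) k - X r i) (X (r + 2) k - X r i) := by
    intro k
    have h1 := hQ (r + 2) k i
    rw [e₂] at h1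
    rw [← hdist, dist_comm, h1]
    unfold dot; simp only [Complex.sub_re, Complex.sub_im]; ring
  have hyz : ∀ k, ⟪Q (r + 2) k - Q (r + 1) j, Q (r + 2) k - Q (r + 1) j⟫ =
      dot (X (r + 2) k - X (r + 1) j) (X (r + 2) k - X (r + 1) j) := by
    intro k
    have h1 := hQ (r + 1) j k
    rw [e₁] at h1
    rw [← hdist, h1]
  have huz : ∀ k, ⟪Q (r + 1) j - Q r i, Q (r + 2) k - Q r i⟫ =
      (t r i j - s r i j) * dot (Complex.I * n r i j) (X (r + 2) k - X r i) := by
    intro k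
    have h1 := hyz k
    rw [← sub_sub_sub_cancel_right (Q (r + 2) k) (Q (r + 1) j) (Q r i), real_inner_sub_sub_self,
      hzz, huu, ← h.edge_sq, real_inner_comm] at h1
    rw [dot_comm, ← hL]
    have h2 : dot (X (r + 2) k - X (r + 1) j) (X (r + 2) k - X (r + 1) j) =
        dot (X (r + 2) k - X r i) (X (r + 2) k - X r i) -
          2 * dot (X (r + 2) k - X r i) (X (r + 1) j - X r i) +
          dot (X (r + 1) j - X r i) (X (r + 1) j - X r i) := by
      unfold dot; simp only [Complex.sub_re, Complex.sub_im]; ring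
    linarith
  have hpyth : ∀ k, ⟪Q (r + 2) k - Q r i, Q (r + 2) k - Q r i⟫ =
      dot (Complex.I * n r i j) (X (r + 2) k - X r i) ^ 2 +
        dot (n r i j) (X r i - X (r + 2) k) ^ 2 := by
    intro k
    rw [hzz]
    unfold dot at hn ⊢
    simp
    linear_combination (-((X (r + 2) k).re - (X r i).re) ^ 2 -
      ((X (r + 2) k).im - (X r i).im) ^ 2) * hn
  obtain ⟨hh₀, hh₁⟩ := (h.vertex hQ r i).1 j
  have hα' : towards (Q r i) (Q (r + 1) j) (Q (r + 2) 1) =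
      Real.cos α • towards (Q r i) (Q (r + 1) j) (Q (r + 2) 0) +
        Real.sin α • ((ε * (-1) ^ ((i : ℕ) + (j : ℕ)) : ℤˣ)) •
          NormedSpace.normalize (cross (Q (r + 1) j - Q r i) (Q (r + 2) 0 - Q r i)) := hα
  obtain ⟨δ, hδ, hc, hs⟩ := cos_sin_of_towards_eq (h.edge_ne_zero r i j) hh₀ hh₁ huu (huz 0)
    (huz 1) (hpyth 0) (hpyth 1) hα'
  refine ⟨δ, hδ, hc, ?_⟩
  rw [frameSin, edgeSin, hI]
  exact hs

end Bricard

end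

theorem theorem6
    (I : Set ℝ) (P : ℝ → Bricard.Placement Bricard.Space) (hP : Bricard.IsFlexOn P I)
    (t₀ : ℝ) (ht₀ : t₀ ∈ I) (hO : Bricard.IsBricardType3 (P t₀))
    (ε : ℤˣ) (r : Fin 3)
    (α : Fin 2 → Fin 2 → ℝ → ℝ)
    (hαc : ∀ i j, ContinuousOn (α i j) I)
    (hα : ∀ i j, ∀ t ∈ I, Bricard.IsDihedralAngle ε (P t) r i j (α i j t))
    (f : ℝ →ₗ[ℚ] ℝ) (hf : f Real.pi = 0) :
    ∀ t ∈ I, ∑ i : Fin 2, ∑ j : Fin 2,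
      dist (P t r i) (P t (r + 1) j) * f (α i j t) = 0 := by
  intro τ hτ
  obtain ⟨p, hp, φ, P', hP', h0, h1⟩ := hO
  obtain ⟨X, κ, n, s, t, hF, hX⟩ := hp.exists_tangentFrame
  have hdist : ∀ r i j, dist (P τ r i) (P τ (r + 1) j) = dist (p r i) (p (r + 1) j) := by
    intro r i j
    rw [hP.2.2 τ hτ t₀ ht₀, ← h1,
      hP'.2.2 1 (Set.right_mem_Icc.2 zero_le_one) 0 (Set.left_mem_Icc.2 zero_le_one), h0]
    exact φ.dist_map _ _
  have hQ : ∀ r i j, dist (P τ r i) (P τ (r + 1) j) ^ 2 =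
      Bricard.dot (X (r + 1) j - X r i) (X (r + 1) j - X r i) := by
    intro r i j
    rw [hdist, hX]
  have hlen : ∀ i j, dist (P τ r i) (P τ (r + 1) j) = |t r i j - s r i j| := by
    intro i j
    rw [← sq_eq_sq₀ dist_nonneg (abs_nonneg _), sq_abs, hQ, hF.edge_sq]
  simp only [hlen]
  refine Bricard.sum_mul_map_angle_eq_zero f hf ε (C := Bricard.frameCos X n (P τ) r 0 0)
    (S := Bricard.frameSin X n (P τ) r) (L := fun i j => t r i j - s r i j)
    (α := fun i j => α i j τ) (hF.edge_ne_zero r) (fun i j => ?_) (hF.sum_frameSin hQ r)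
  rw [← hF.frameCos_eq hQ r i j]
  exact hF.cos_sin_of_isDihedralAngle hQ (hα i j τ hτ)
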